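/- **Setting.** Let $M,s\ge 0$ be integers and $c_1,\dots,c_s\in\mathbb R$. For the semi-linear SDE $$dX=A(t)X\,dt+\sum_{m=0}^M g_m(X,t)\star dW_m,\qquad dW_0=dt,$$ in $\mathbb R^d$ with $A:\mathbb R\to\mathbb R^{d\times d}$ and $g_m:\mathbb R^d\times\mathbb R\to\mathbb R^d$ of class $C^\infty$, consider one step, from $(x_0,t_0)$ with step size $h$, of the exponential Runge–Kutta method $$H_i=Z_{i0}x_0+\sum_{m=0}^M\sum_{j=1}^sZ_{ij}^{(m)}g_m(H_j,t_0+c_jh),\qquad Y_1=z_0x_0+\sum_{m=0}^M\sum_{i=1}^sz_i^{(m)}g_m(H_i,t_0+c_ih),$$ with (random) $d\times d$ matrices $Z_{i0},Z_{ij}^{(m)},z_0,z_i^{(m)}$ depending on $A,t_0,h$. *Trees.* Trees are rooted, unordered, with nodes labelled $0,\dots,M$, $A$ or $t$; $[\tau_1,\dots,\tau_\kappa]_l$ joins $\tau_1,\dots,\tau_\kappa$ to a root labelled $l$, and $\bullet_l=[\,]_l$. The set $T=\{\emptyset\}\cup T_g\cup T_A$ is the smallest with $[\tau_1,\dots,\tau_\kappa]_m\in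 T_g$ ($\kappa\ge0$) whenever all $\tau_k\in (T\setminus\{\emptyset\})\cup\{\bullet_t\}$, $\bullet_A\in T_A$, and $[\tau_1,\bullet_t^{\kappa-1}]_A\in T_A$ ($\kappa\ge 1$) whenever $\tau_1\in (T\setminus\{\emptyset\})\cup\{\bullet_t\}$. $\bar T_A\subset T$ is the set of trees (including $\emptyset$) without nodes labelled $0,\dots,M$. Let $\alpha(\emptyset)=1$, $\alpha([\tau_1,\dots,\tau_\kappa]_l)=\frac1{r_1!\cdots r_q!}\prod_k\alpha(\tau_k)$, where $r_1,\dots,r_q$ count equal trees among the $\tau_k$. Elementary differentials: $F(\emptyset)(x,t)=x$; $F([\tau_1,\dots,\tau_\kappa]_m)$ is the $\kappa$-th derivative of $g_m$ at $(x,t)$ applied to the directions $(F(\tau_k),0)$ for $\tau_k\neq\bullet_t$ and $(0,1)$ for $\tau_k=\bullet_t$; $F(\bullet_A)=A(t)x$, $F([\bullet_t^\kappa]_A)=A^{(\kappa)}(t)x$, and $F([\tau_1,\bullet_t^{\kappa-1}]_A)=A^{(\kappa-1)}(t)F(\tau_1)$ for $\tau_1\ne\bullet_t$. A B-series is $B(\phi,x,t;h)=\sum_{\tau\in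 T}\alpha(\tau)\phi(\tau)(h)F(\tau)(x,t)$ with (random) weights $\phi(\tau)(h)$. $SP(\tau)$ is the set of pairs $(\vartheta,\{\delta\})$ such that cutting exactly one nonempty branch $\delta$ (possibly all of $\tau$) off $\tau$ leaves $\vartheta$. **Assumption.** The matrices $Z_{i0},Z_{ij}^{(m)},z_0,z_i^{(m)}$ are B-series over $\bar T_A$: each of them, denoted $Z$, satisfies $Zx=\sum_{\tau\in\bar T_A}\alpha(\tau)Z(\tau)(h)F(\tau)(x,t_0)$ for all $x$ (convergent in (c); formal in (b)), and $Z_{i0}(\emptyset)=z_0(\emptyset)\equiv1$. **Theorem.** (a) For every $\tau\in T\setminus\bar T_A$ there is exactly one $(\vartheta,\{\delta\})\in SP(\tau)$ with $\vartheta\in\bar T_A$ and $\delta\in T_g$; write $\delta=[\tau_1,\dots,\tau_\kappa]_m$. There are weights $\Phi_i,\Phi$, depending only on the weights of the coefficients and on $c$, uniquely determined on $T$, with $\Phi_i(\emptyset)=\Phi(\emptyset)=1$, $\Phi_i(\bullet_t)(h)=c_ih$, $\Phi_i(\bullet_m)=\sum_jZ_{ij}^{(m)}(\emptyset)$, $\Phi(\bullet_m)=\sum_iz_i^{(m)}(\emptyset)$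 and $$\Phi_i(\tau)=\begin{cases}Z_{i0}(\tau)&\tau\in\bar T_A,\\ \sum_{j=1}^sZ_{ij}^{(m)}(\vartheta)\prod_{k=1}^\kappa\Phi_j(\tau_k)&\text{otherwise,}\end{cases}\qquad \Phi(\tau)=\begin{cases}z_0(\tau)&\tau\in\bar T_A,\\ \sum_{i=1}^sz_i^{(m)}(\vartheta)\prod_{k=1}^\kappa\Phi_i(\tau_k)&\text{otherwise}\end{cases}$$ for $\tau\in T$. They are random variables if the weights of the coefficients are. (b) $H_i=B(\Phi_i,x_0,t_0;h)$ and $Y_1=B(\Phi,x_0,t_0;h)$ as formal series: when B-series are read as formal series graded by the number of nodes, each factor $g_m$ and each factor $c_jh$ has degree $1$, and $g_m(H_j,t_0+c_jh)$ is the formal Taylor expansion at $(x_0,t_0)$, the method has exactly one solution $(H_1,\dots,H_s,Y_1)$, and it is given by these B-series. (c) Suppose in addition that the $g_m$ are real analytic on $\mathbb R^d\times\mathbb R$ and that, for the given $h$ and the given random event, the B-series of the coefficients converge to the matrices and the series $B(\Phi_i,x_0,t_0;h)$ and the B-series of $g_m(H_i,t_0+c_ih)$ (with weight $\prod_k\Phi_i(\tau_k)(h)$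 at $[\tau_1,\dots,\tau_\kappa]_m\in T$, and $0$ at all other trees) converge unconditionally. Then $H_i:=B(\Phi_i,x_0,t_0;h)$, $i=1,\dots,s$, solve the stage equations, and the resulting $Y_1$ is the sum of the convergent series $B(\Phi,x_0,t_0;h)$. -/

import Mathlib

open scoped ContDiff

noncomputable section

namespace BSeriesERK

/-- Node labels: `g m` for the coefficient `g_m` (`m = 0, …, M`), `A` for the linear term
`A(t) x`, and `t` for the time variable. -/
inductive Label (M : ℕ) : Type
  | g (m : Fin (M + 1)) : Label M
  | A : Label M
  | t : Label M

/-- Nonempty rooted labelled trees with *ordered* children. -/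
inductive PreTree (M : ℕ) : Type
  | node (l : Label M) (n : ℕ) (child : Fin n → PreTree M) : PreTree M

namespace PreTree

variable {M : ℕ}

/-- Two ordered trees are equivalent if they differ only by the order of the branches. -/
def Equiv : PreTree M → PreTree M → Prop
  | node l n u, node l' n' u' =>
      l = l' ∧ ∃ e : _root_.Equiv (Fin n) (Fin n'), ∀ i, Equiv (u i) (u' (e i))

theorem Equiv.refl : ∀ p : PreTree M, Equiv p p
  | node _ _ u => ⟨rfl, _root_.Equiv.refl _, fun i => Equiv.refl (u i)⟩

theorem Equiv.symm : ∀ {p q : PreTree M}, Equiv p q → Equiv q p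
  | node _ _ u, node _ _ u', ⟨hl, e, h⟩ =>
      ⟨hl.symm, e.symm, fun i => by
        have := Equiv.symm (h (e.symm i))
        rwa [e.apply_symm_apply] at this⟩

theorem Equiv.trans : ∀ {p q r : PreTree M}, Equiv p q → Equiv q r → Equiv p r
  | node _ _ _, node _ _ _, node _ _ _, ⟨hl, e, h⟩, ⟨hl', e', h'⟩ =>
      ⟨hl.trans hl', e.trans e', fun i => Equiv.trans (h i) (h' (e i))⟩

instance setoid (M : ℕ) : Setoid (PreTree M) :=
  ⟨Equiv, Equiv.refl, Equiv.symm, Equiv.trans⟩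

/-- The label of the root. -/
def root : PreTree M → Label M
  | node l _ _ => l

/-- The number of nodes. -/
def size : PreTree M → ℕ
  | node _ _ u => 1 + ∑ i, size (u i)

end PreTree

/-- Nonempty rooted labelled trees (the order of the branches is irrelevant). -/
def Tree (M : ℕ) : Type := Quotient (PreTree.setoid M)

/-- The tree represented by an ordered tree. -/
def Tree.ofPre {M : ℕ} (p : PreTree M) : Tree M := Quotient.mk (PreTree.setoid M) p

/-- A chosen ordered representative of a tree. -/
def Tree.repr {M : ℕ} (τ : Tree M) : PreTree M := Quotient.out τ

theorem Tree.ofPre_repr {M : ℕ} (τ : Tree M) : Tree.ofPre τ.repr = τ := Quotient.out_eq τ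

theorem Tree.ofPre_eq {M : ℕ} {p q : PreTree M} : Tree.ofPre p = Tree.ofPre q ↔ p ≈ q :=
  Quotient.eq

namespace PreTree

variable {M : ℕ}

/-- The multiset of the subtrees attached to the root. -/
def children : PreTree M → Multiset (Tree M)
  | node _ _ u => Finset.univ.val.map fun i => Tree.ofPre (u i)

open Classical in
/-- `α([τ₁,…,τ_κ]) = (∏ α(τ_k)) / (r₁! r₂! ⋯)`, where the `r`'s count equal trees among the
`τ_k`. -/
def alpha : PreTree M → ℝ
  | node l n u =>
      (∏ i, alpha (u i)) /
        ((∏ σ ∈ (children (node l n u)).toFinset, Nat.factorial ((children (node l n u)).count σ) : ℕ) : ℝ)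

theorem root_congr : ∀ p q : PreTree M, p ≈ q → p.root = q.root
  | node _ _ _, node _ _ _, h => h.1

theorem children_congr : ∀ p q : PreTree M, p ≈ q → p.children = q.children
  | node _ n u, node _ n' u', ⟨_, e, h⟩ => by
      have h1 : (fun i => Tree.ofPre (u i)) = (fun i => Tree.ofPre (u' i)) ∘ e :=
        funext fun i => Tree.ofPre_eq.mpr (h i)
      simp only [children]
      rw [h1, ← Multiset.map_map, Multiset.map_univ_val_equiv]

theorem size_congr : ∀ p q : PreTree M, p ≈ q → p.size = q.size
  | node _ n u, node _ n' u', ⟨_, e, h⟩ => by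
      simp only [size]
      congr 1
      exact Fintype.sum_equiv e _ _ fun i => size_congr _ _ (h i)

theorem alpha_congr : ∀ p q : PreTree M, p ≈ q → p.alpha = q.alpha
  | node l n u, node l' n' u', h => by
      have hc := children_congr _ _ h
      obtain ⟨_, e, h⟩ := h
      simp only [alpha, hc]
      congr 1
      exact Fintype.prod_equiv e _ _ fun i => alpha_congr _ _ (h i)

end PreTree

namespace Tree

variable {M : ℕ}

/-- The label of the root. -/
def root (τ : Tree M) : Label M := Quotient.lift PreTree.root PreTree.root_congr τ

/-- The multiset of the subtrees attached to the root. -/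
def children (τ : Tree M) : Multiset (Tree M) :=
  Quotient.lift PreTree.children PreTree.children_congr τ

/-- The number of nodes. -/
def size (τ : Tree M) : ℕ := Quotient.lift PreTree.size PreTree.size_congr τ

/-- The combinatorial coefficient `α(τ)`. -/
def alpha (τ : Tree M) : ℝ := Quotient.lift PreTree.alpha PreTree.alpha_congr τ

/-- The tree `[τ₁,…,τ_κ]_l` obtained by joining the trees of the multiset `S` to a new root with
label `l`. -/
def bracket (l : Label M) (S : Multiset (Tree M)) : Tree M :=
  Tree.ofPre (PreTree.node l S.toList.length fun i => (S.toList.get i).repr)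

/-- The single node with label `l`. -/
def leaf (l : Label M) : Tree M := bracket l 0

theorem root_bracket (l : Label M) (S : Multiset (Tree M)) : (bracket l S).root = l := rfl

theorem children_bracket (l : Label M) (S : Multiset (Tree M)) : (bracket l S).children = S := by
  have h : (bracket l S).children
      = Finset.univ.val.map fun i => Tree.ofPre (S.toList.get i).repr := rfl
  simp only [h, ofPre_repr, Fin.univ_def]
  conv_rhs => rw [← S.coe_toList]
  rw [Multiset.map_coe]
  exact congrArg _ (List.map_get_finRange _)

open Classical in
theorem exists_equiv_of_map_eq {α : Type*} {n : ℕ} (f f' : Fin n → α)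
    (h : Finset.univ.val.map f = Finset.univ.val.map f') :
    ∃ e : Fin n ≃ Fin n, ∀ i, f i = f' (e i) := by
  have hcard : ∀ a, Fintype.card {i // f i = a} = Fintype.card {i // f' i = a} := by
    intro a
    have := congrArg (Multiset.count a) h
    rw [Multiset.count_map, Multiset.count_map] at this
    rw [Fintype.card_subtype, Fintype.card_subtype]
    simpa [Finset.card, eq_comm] using this
  refine ⟨(Equiv.sigmaFiberEquiv f).symm.trans ((Equiv.sigmaCongrRight fun a =>
    Fintype.equivOfCardEq (hcard a)).trans (Equiv.sigmaFiberEquiv f')), fun i => ?_⟩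
  exact (((Fintype.equivOfCardEq (hcard (f i))) ⟨i, rfl⟩).2).symm

theorem eq_of_root_children {σ τ : Tree M} (hr : σ.root = τ.root)
    (hc : σ.children = τ.children) : σ = τ := by
  rw [← ofPre_repr σ, ← ofPre_repr τ] at hr hc ⊢
  generalize σ.repr = p at hr hc ⊢
  generalize τ.repr = q at hr hc ⊢
  obtain ⟨l, n, u⟩ := p
  obtain ⟨l', n', u'⟩ := q
  have hc' : (Finset.univ.val.map fun i => Tree.ofPre (u i))
      = Finset.univ.val.map fun i => Tree.ofPre (u' i) := hc
  have hn : n = n' := by simpa using congrArg Multiset.card hc'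
  subst hn
  obtain ⟨e, he⟩ := exists_equiv_of_map_eq _ _ hc'
  exact ofPre_eq.mpr ⟨hr, e, fun i => ofPre_eq.mp (he i)⟩

/-- Every tree is `[τ₁,…,τ_κ]_l` for its root label and its multiset of subtrees. -/
theorem bracket_root_children (τ : Tree M) : bracket τ.root τ.children = τ :=
  eq_of_root_children (root_bracket _ _) (children_bracket _ _)

end Tree

section TreeSets

variable {M : ℕ}

/-- The nonempty trees of `T = T_g ∪ T_A`:  `[τ₁,…,τ_κ]_m` with all `τ_k ∈ T ∪ {•_t}`
(`κ = 0` is the node `•_m`), the node `•_A`, and `[τ₁, •_t^n]_A` with `τ₁ ∈ T ∪ {•_t}`. -/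
inductive InT : Tree M → Prop
  | g (m : Fin (M + 1)) (S : Multiset (Tree M))
      (hS : ∀ σ ∈ S, σ ≠ Tree.leaf Label.t → InT σ) : InT (Tree.bracket (Label.g m) S)
  | leafA : InT (Tree.leaf Label.A)
  | A (σ : Tree M) (n : ℕ) (hσ : σ ≠ Tree.leaf Label.t → InT σ) :
      InT (Tree.bracket Label.A (σ ::ₘ Multiset.replicate n (Tree.leaf Label.t)))

/-- Trees without any node labelled by some `g m`. -/
inductive GFree : Tree M → Prop
  | mk (l : Label M) (S : Multiset (Tree M)) (hl : ∀ m, l ≠ Label.g m)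
      (hS : ∀ σ ∈ S, GFree σ) : GFree (Tree.bracket l S)

/-- The set `T` of trees, with the empty tree `∅ = none`. -/
def treesT (M : ℕ) : Set (Option (Tree M)) := {τ | ∀ σ ∈ τ, InT σ}

/-- The set `T_g` of the trees in `T` whose root is some `g m`. -/
def treesTg (M : ℕ) : Set (Tree M) := {τ | InT τ ∧ ∃ m, τ.root = Label.g m}

/-- The set `T̄_A` of the trees in `T`, including `∅`, that have no node `g m`. -/
def treesTA (M : ℕ) : Set (Option (Tree M)) := {τ | ∀ σ ∈ τ, InT σ ∧ GFree σ}

/-- `IsST τ ϑ ω`: the pair `(ϑ, ω)` belongs to `ST(τ)`, i.e. `ϑ` is a subtree of `τ`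
(empty or containing the root) and `ω` is the remainder multiset of the branches cut off.
Either all of `τ` is cut off, or the root is kept and each of its branches `τ_i` is split as
`(ϑ_i, ω_i)`. Empty trees are not recorded, neither among the branches of `ϑ` nor in `ω`. -/
inductive IsST : Tree M → Option (Tree M) → Multiset (Tree M) → Prop
  | cut (τ : Tree M) : IsST τ none {τ}
  | keep (l : Label M) (L : Multiset (Tree M × Option (Tree M) × Multiset (Tree M)))
      (hL : ∀ p ∈ L, IsST p.1 p.2.1 p.2.2) :
      IsST (Tree.bracket l (L.map fun p => p.1))
        (some (Tree.bracket l (L.filterMap fun p => p.2.1)))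
        (L.map fun p => p.2.2).sum

/-- `SP(τ)`: the splittings `(ϑ, {δ})` in `ST(τ)` with exactly one branch `δ` cut off. -/
def SP (τ : Tree M) : Set (Option (Tree M) × Tree M) := {p | IsST τ p.1 {p.2}}

/-- `α`, with `α(∅) = 1`. -/
def alpha : Option (Tree M) → ℝ
  | none => 1
  | some τ => τ.alpha

/-- The number of nodes, `0` for `∅`. -/
def size : Option (Tree M) → ℕ
  | none => 0
  | some τ => τ.size

end TreeSets

section Series

variable {M d : ℕ}

/-- Elementary differentials, computed on an ordered representative (for smooth `g` the order of
the branches is irrelevant, since derivatives are symmetric). The functions `g m` are functions of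
the pair `(x, t)`. A branch `•_t` contributes the direction `(0, 1)`, any other branch `σ` the
direction `(F(σ), 0)`. For `[σ, •_t^{κ-1}]_A` with `σ ≠ •_t` the sum has the single nonzero term
`A^{(κ-1)}(t₀) F(σ)`. The value at a root `t` is not used. -/
def PreTree.elemDiff (A : ℝ → EuclideanSpace ℝ (Fin d) →L[ℝ] EuclideanSpace ℝ (Fin d))
    (g : Fin (M + 1) → EuclideanSpace ℝ (Fin d) × ℝ → EuclideanSpace ℝ (Fin d))
    (x : EuclideanSpace ℝ (Fin d)) (t₀ : ℝ) : PreTree M → EuclideanSpace ℝ (Fin d)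
  | PreTree.node (Label.g m) n u =>
      open Classical in
      iteratedFDeriv ℝ n (g m) (x, t₀) fun i =>
        if (u i).root = Label.t then (0, 1) else (PreTree.elemDiff A g x t₀ (u i), 0)
  | PreTree.node Label.A n u =>
      open Classical in
      if ∀ i, (u i).root = Label.t then iteratedDeriv n A t₀ x
      else ∑ i, if (u i).root = Label.t then 0
        else iteratedDeriv (n - 1) A t₀ (PreTree.elemDiff A g x t₀ (u i))
  | PreTree.node Label.t _ _ => 0

/-- The elementary differential `F(τ)(x, t₀)`, with `F(∅)(x, t₀) = x`. -/
def elemDiff (A : ℝ → EuclideanSpace ℝ (Fin d) →L[ℝ] EuclideanSpace ℝ (Fin d))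
    (g : Fin (M + 1) → EuclideanSpace ℝ (Fin d) × ℝ → EuclideanSpace ℝ (Fin d))
    (x : EuclideanSpace ℝ (Fin d)) (t₀ : ℝ) : Option (Tree M) → EuclideanSpace ℝ (Fin d)
  | none => x
  | some τ => τ.repr.elemDiff A g x t₀

/-- The term `α(τ) · φ(τ) · F(τ)(x, t₀)` of a B-series. -/
def bTerm (A : ℝ → EuclideanSpace ℝ (Fin d) →L[ℝ] EuclideanSpace ℝ (Fin d))
    (g : Fin (M + 1) → EuclideanSpace ℝ (Fin d) × ℝ → EuclideanSpace ℝ (Fin d))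
    (x : EuclideanSpace ℝ (Fin d)) (t₀ : ℝ) (φ : Option (Tree M) → ℝ) (τ : Option (Tree M)) :
    EuclideanSpace ℝ (Fin d) :=
  (alpha τ * φ τ) • elemDiff A g x t₀ τ

/-- The matrix `L` is a B-series over `T̄_A` with weights `ζ`: `L x = B(ζ, x, t₀)` for all `x`. -/
def HasCoeffSeries (A : ℝ → EuclideanSpace ℝ (Fin d) →L[ℝ] EuclideanSpace ℝ (Fin d))
    (g : Fin (M + 1) → EuclideanSpace ℝ (Fin d) × ℝ → EuclideanSpace ℝ (Fin d)) (t₀ : ℝ)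
    (ζ : Option (Tree M) → ℝ) (L : EuclideanSpace ℝ (Fin d) →L[ℝ] EuclideanSpace ℝ (Fin d)) :
    Prop :=
  ∀ x, HasSum (fun τ : treesTA M => bTerm A g x t₀ ζ τ) (L x)

/-- The weights of the B-series of `g_m(B(φ, x₀, t₀), ·)`: `∏ φ(τ_k)` at `[τ₁,…,τ_κ]_m` and `0`
at all other trees. -/
def compWeight (m : Fin (M + 1)) (φ : Option (Tree M) → ℝ) : Option (Tree M) → ℝ
  | none => 0
  | some τ =>
      open Classical in
      if τ.root = Label.g m then (τ.children.map fun σ => φ (some σ)).prod else 0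

/-- The homogeneous part of degree `n` (`n` nodes) of the formal B-series over the set `𝒯`
of trees. There are only finitely many trees with `n` nodes. -/
def gradedPart (𝒯 : Set (Option (Tree M)))
    (A : ℝ → EuclideanSpace ℝ (Fin d) →L[ℝ] EuclideanSpace ℝ (Fin d))
    (g : Fin (M + 1) → EuclideanSpace ℝ (Fin d) × ℝ → EuclideanSpace ℝ (Fin d))
    (x : EuclideanSpace ℝ (Fin d)) (t₀ : ℝ) (φ : Option (Tree M) → ℝ) (n : ℕ) :
    EuclideanSpace ℝ (Fin d) :=
  ∑ᶠ (τ : Option (Tree M)) (_ : τ ∈ 𝒯 ∧ size τ = n), bTerm A g x t₀ φ τ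

/-- The coefficient of `ε^b` in the Taylor expansion at `ε = 0` of `f(∑ₖ ε^k H_k, t₀ + ε r)` for a
formal series `∑ₖ ε^k H_k`; the terms with `k > b` do not contribute to it. -/
def taylorPart (f : EuclideanSpace ℝ (Fin d) × ℝ → EuclideanSpace ℝ (Fin d))
    (H : ℕ → EuclideanSpace ℝ (Fin d)) (t₀ r : ℝ) (b : ℕ) : EuclideanSpace ℝ (Fin d) :=
  ((Nat.factorial b : ℝ)⁻¹) •
    iteratedDeriv b (fun ε : ℝ => f (∑ k ∈ Finset.range (b + 1), ε ^ k • H k, t₀ + ε * r)) 0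

/-- One line `Z₀ x₀ + ∑_m ∑_j Z_j^{(m)} g_m(H_j, t₀ + c_j h)` of the method, as a vector. -/
def methodLine {s : ℕ} (g : Fin (M + 1) → EuclideanSpace ℝ (Fin d) × ℝ → EuclideanSpace ℝ (Fin d))
    (x₀ : EuclideanSpace ℝ (Fin d)) (t₀ h : ℝ) (c : Fin s → ℝ)
    (Z₀ : EuclideanSpace ℝ (Fin d) →L[ℝ] EuclideanSpace ℝ (Fin d))
    (Z : Fin (M + 1) → Fin s → EuclideanSpace ℝ (Fin d) →L[ℝ] EuclideanSpace ℝ (Fin d))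
    (H : Fin s → EuclideanSpace ℝ (Fin d)) : EuclideanSpace ℝ (Fin d) :=
  Z₀ x₀ + ∑ m, ∑ j, Z m j (g m (H j, t₀ + c j * h))

/-- The part of degree `n` of the same line, for formal series `H j` (graded by the number of
nodes), when the matrices are the formal B-series over `T̄_A` with weights `ζ₀`, `ζ m j`. Each
factor `g_m` carries one node and the time increment `c_j h` carries one node `•_t`. -/
def formalLine {s : ℕ} (A : ℝ → EuclideanSpace ℝ (Fin d) →L[ℝ] EuclideanSpace ℝ (Fin d))
    (g : Fin (M + 1) → EuclideanSpace ℝ (Fin d) × ℝ → EuclideanSpace ℝ (Fin d))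
    (x₀ : EuclideanSpace ℝ (Fin d)) (t₀ h : ℝ) (c : Fin s → ℝ)
    (ζ₀ : Option (Tree M) → ℝ) (ζ : Fin (M + 1) → Fin s → Option (Tree M) → ℝ)
    (H : Fin s → ℕ → EuclideanSpace ℝ (Fin d)) (n : ℕ) : EuclideanSpace ℝ (Fin d) :=
  gradedPart (treesTA M) A g x₀ t₀ ζ₀ n +
    ∑ m, ∑ j, ∑ a ∈ Finset.range n,
      gradedPart (treesTA M) A g (taylorPart (g m) (H j) t₀ (c j * h) (n - 1 - a)) t₀ (ζ m j) a

end Series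

/-- The recursion for the weights `Φ i` of the stage values and `Φ'` of the one-step approximation.
Weights depend on the tree, the step size `h` and the random event `w`; `ζ₀ i`, `ζ m i j`, `η₀`,
`η m i` are the weights of the coefficients `Z_{i0}`, `Z_{ij}^{(m)}`, `z₀`, `z_i^{(m)}`. -/
structure IsERKWeights {M s : ℕ} {Ω : Type*} (c : Fin s → ℝ)
    (ζ₀ : Fin s → Option (Tree M) → ℝ → Ω → ℝ)
    (ζ : Fin (M + 1) → Fin s → Fin s → Option (Tree M) → ℝ → Ω → ℝ)
    (η₀ : Option (Tree M) → ℝ → Ω → ℝ)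
    (η : Fin (M + 1) → Fin s → Option (Tree M) → ℝ → Ω → ℝ)
    (Φ : Fin s → Option (Tree M) → ℝ → Ω → ℝ) (Φ' : Option (Tree M) → ℝ → Ω → ℝ) : Prop where
  stage_empty : ∀ i h w, Φ i none h w = 1
  step_empty : ∀ h w, Φ' none h w = 1
  stage_time : ∀ i h w, Φ i (some (Tree.leaf Label.t)) h w = c i * h
  stage_leaf : ∀ i m h w,
    Φ i (some (Tree.leaf (Label.g m))) h w = ∑ j, ζ m i j none h w
  step_leaf : ∀ m h w,
    Φ' (some (Tree.leaf (Label.g m))) h w = ∑ i, η m i none h w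
  stage_TA : ∀ i, ∀ τ ∈ treesTA M, ∀ h w, Φ i τ h w = ζ₀ i τ h w
  step_TA : ∀ τ ∈ treesTA M, ∀ h w, Φ' τ h w = η₀ τ h w
  stage_split : ∀ i (τ : Tree M), some τ ∈ treesT M → some τ ∉ treesTA M →
    ∀ ϑ m S, (ϑ, Tree.bracket (Label.g m) S) ∈ SP τ → ϑ ∈ treesTA M →
      Tree.bracket (Label.g m) S ∈ treesTg M → ∀ h w,
      Φ i (some τ) h w =
        ∑ j, ζ m i j ϑ h w * (S.map fun σ => Φ j (some σ) h w).prod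
  step_split : ∀ τ : Tree M, some τ ∈ treesT M → some τ ∉ treesTA M →
    ∀ ϑ m S, (ϑ, Tree.bracket (Label.g m) S) ∈ SP τ → ϑ ∈ treesTA M →
      Tree.bracket (Label.g m) S ∈ treesTg M → ∀ h w,
      Φ' (some τ) h w =
        ∑ i, η m i ϑ h w * (S.map fun σ => Φ i (some σ) h w).prod

end BSeriesERK

end

/-! A tree of `T` has a simple shape. Below a node `A` there is at most one branch other than `•_t`,
so starting at the root one descends along nodes `A`, the k-th carrying `n_k` extra leaves `•_t`,
until the path ends or meets a first node `g m`. Hence a tree of `T` is either `chain l`, and these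
are exactly the trees of `T̄_A`, or `graft l δ` with `δ ∈ T_g`, and the list `l` and the tree `δ`
are uniquely determined (`InT.cases_chain`, `chain_injective`, `graft_injective`). The pair `(chain
l, δ)` is the only splitting of the required kind (`SP_unique`), and since branches of `δ` are
smaller than the tree, the recursion for the weights is well founded.

Elementary differentials and coefficients factor along this decomposition: `F(graft l δ)` is a
product of derivatives of `A`, depending only on `l`, applied to `F(δ)`, and `α(graft l δ)` is `∏
1/n_k!` times `α(δ)`. So applying a matrix series over `T̄_A` to a series over `T_g` multiplies out
to a series over all `graft l δ`, whose weights are those of the recursion (`bTerm_graft`). Stages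
and final step have the same form; `IsLine` treats both at once.

It remains to expand `g_m` along a B-series. Marking each node by a factor `ε` turns the series into
a curve; its Taylor coefficients under `g_m` are sums over words of trees, and grouping words with
the same multiset of letters turns `1/n!` into the symmetry factor of `α` (`taylorPart_gradedPart`).
In the formal method the degree `n` part uses only stage parts of degree below `n`, which gives
existence and uniqueness.

For convergent series, both sides become functions of `ε`, analytic for `|ε| < 1` with equal Taylor
coefficients at `0`. The identity theorem makes them agree there, and absolute convergence at `ε =
1` carries the equality to that endpoint (`apply_tsum_eq_tsum_taylor`). The product of matrix series
and vector series is rearranged by absolute summability in finite dimension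
(`HasCoeffSeries.hasSum_prod`). -/

namespace BSeriesERK

/-! ### Symmetry of higher derivatives and Taylor coefficients along polynomial curves -/

section Calculus

variable {E F : Type*} [NormedAddCommGroup E] [NormedSpace ℝ E]
  [NormedAddCommGroup F] [NormedSpace ℝ F]

/-- Iterated derivatives of smooth functions are symmetric. -/
theorem iteratedFDeriv_comp_perm {f : E → F} (hf : ContDiff ℝ ∞ f) {n : ℕ} (x : E)
    (v : Fin n → E) (σ : Equiv.Perm (Fin n)) :
    iteratedFDeriv ℝ n f x (v ∘ σ) = iteratedFDeriv ℝ n f x v := by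
  induction n generalizing x with
  | zero => congr 1; exact Subsingleton.elim _ _
  | succ n ih =>
    -- Adjacent transpositions generate the symmetric group, so invariance under these suffices.
    have hmem : σ ∈ Submonoid.closure
        (Set.range fun i : Fin n ↦ Equiv.swap i.castSucc i.succ) := by
      rw [Equiv.Perm.mclosure_swap_castSucc_succ]; trivial
    induction hmem using Submonoid.closure_induction generalizing v with
    | one => rfl
    | mul σ τ _ _ hσ hτ =>
      have := hτ (v ∘ σ)
      rw [← hσ v, ← this]; rfl
    | mem σ hσ =>
      obtain ⟨i, rfl⟩ := hσ
      have hd : ∀ k, ContDiff ℝ ∞ (iteratedFDeriv ℝ k f) := fun k =>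
        hf.iteratedFDeriv_right (by exact_mod_cast le_top)
      cases n with
      | zero => exact i.elim0
      | succ n =>
        induction i using Fin.cases with
        | zero =>
          -- Swapping the first two slots is the symmetry of the second derivative of the `n`-th
          -- derivative.
          have hs : IsSymmSndFDerivAt ℝ (iteratedFDeriv ℝ n f) x :=
            (hd n).contDiffAt.isSymmSndFDerivAt (by
              simp only [minSmoothness_of_isRCLikeNormedField]
              exact WithTop.coe_le_coe.mpr le_top)
          have key : ∀ w : Fin (n + 2) → E, iteratedFDeriv ℝ (n + 2) f x w =
              fderiv ℝ (fderiv ℝ (iteratedFDeriv ℝ n f)) x (w 0) (w 1)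
                (fun i => w i.succ.succ) := by
            intro w
            have hd1 : DifferentiableAt ℝ (fderiv ℝ (iteratedFDeriv ℝ n f)) x :=
              ((hd n).fderiv_right (m := ∞) (by simp)).differentiable (by simp) x
            rw [iteratedFDeriv_succ_apply_left,
              ← fderiv_continuousMultilinear_apply_const_apply
                (((hd (n + 1)).differentiable (by simp)) x)]
            have h1 : (fun y => iteratedFDeriv ℝ (n + 1) f y (Fin.tail w)) = fun y =>
                fderiv ℝ (iteratedFDeriv ℝ n f) y (w 1) (fun i => w i.succ.succ) := by
              funext y
              rw [iteratedFDeriv_succ_apply_left]; rfl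
            rw [h1, fderiv_continuousMultilinear_apply_const_apply
              (hd1.clm_apply (differentiableAt_const _)), fderiv_clm_apply hd1
              (differentiableAt_const _)]
            simp
          rw [key, key]
          simp only [Function.comp]
          have e0 : (Equiv.swap (Fin.castSucc (0 : Fin (n + 1))) (Fin.succ 0)) 0 = 1 := by
            simp
          have e1 : (Equiv.swap (Fin.castSucc (0 : Fin (n + 1))) (Fin.succ 0)) 1 = 0 := by
            simp
          have e2 : ∀ j : Fin n, (Equiv.swap (Fin.castSucc (0 : Fin (n + 1))) (Fin.succ 0))
              j.succ.succ = j.succ.succ := by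
            intro j
            apply Equiv.swap_apply_of_ne_of_ne
            · simp
            · simp [Fin.ext_iff]
          simp only [e0, e1, e2]
          rw [hs.eq]
        | succ j =>
          -- A swap that fixes slot `0` acts on the lower derivative only, where the induction
          -- hypothesis holds at every point and may be differentiated.
          have key : ∀ w : Fin (n + 2) → E, iteratedFDeriv ℝ (n + 2) f x w =
              fderiv ℝ (fun y => iteratedFDeriv ℝ (n + 1) f y (Fin.tail w)) x (w 0) := by
            intro w
            rw [iteratedFDeriv_succ_apply_left,
              fderiv_continuousMultilinear_apply_const_apply
                (((hd (n + 1)).differentiable (by simp)) x)]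
          rw [key, key]
          have e0 : (Equiv.swap (Fin.castSucc (Fin.succ j)) (Fin.succ j.succ)) 0 = 0 := by
            apply Equiv.swap_apply_of_ne_of_ne <;> simp [Fin.ext_iff]
          have e2 : Fin.tail (v ∘ Equiv.swap (Fin.castSucc (Fin.succ j)) (Fin.succ j.succ)) =
              Fin.tail v ∘ Equiv.swap j.castSucc j.succ := by
            funext k
            simp only [Fin.tail, Function.comp]
            congr 1
            simp only [Equiv.swap_apply_def]
            simp only [Fin.ext_iff, Fin.val_succ, Fin.val_castSucc, Nat.add_right_cancel_iff]
            split_ifs <;> rfl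
          simp only [e2, Function.comp_apply, e0]
          simp only [ih]

/-- The derivatives of `f ∘ γ` at a point up to some order depend only on those of `f` and `γ`. -/
theorem iteratedDeriv_comp_congr {f f' : E → F} {γ γ' : ℝ → E} {t : ℝ} {b : ℕ}
    (hf : ContDiff ℝ ∞ f) (hf' : ContDiff ℝ ∞ f') (hγ : ContDiffAt ℝ ∞ γ t)
    (hγ' : ContDiffAt ℝ ∞ γ' t)
    (h : ∀ k ≤ b, iteratedFDeriv ℝ k f (γ t) = iteratedFDeriv ℝ k f' (γ t))
    (h' : ∀ k ≤ b, iteratedDeriv k γ t = iteratedDeriv k γ' t) :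
    iteratedDeriv b (f ∘ γ) t = iteratedDeriv b (f' ∘ γ') t := by
  have h0 : γ t = γ' t := by simpa using h' 0 (Nat.zero_le _)
  have hb : (b : WithTop ℕ∞) ≤ ∞ := by exact_mod_cast le_top
  -- Faà di Bruno: only derivatives of order at most `b` of either function occur.
  rw [iteratedDeriv_vcomp_eq_sum_orderedFinpartition hf.contDiffAt hγ hb,
    iteratedDeriv_vcomp_eq_sum_orderedFinpartition hf'.contDiffAt hγ' hb]
  refine Finset.sum_congr rfl fun c _ => ?_
  rw [← h0, h _ c.length_le]
  congr 1
  funext j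
  exact h' _ (c.partSize_le j)

/-- A smooth function has the same derivatives at `p` as its Taylor polynomial. -/
theorem exists_taylor_polynomial {f : E → F} [CompleteSpace F] (hf : ContDiff ℝ ∞ f) (p : E)
    (b : ℕ) :
    ContDiff ℝ ∞ (fun y => ∑ n ∈ Finset.range (b + 1),
      ((n.factorial : ℝ)⁻¹) • iteratedFDeriv ℝ n f p fun _ => y - p) ∧
    ∀ k ≤ b, iteratedFDeriv ℝ k (fun y => ∑ n ∈ Finset.range (b + 1),
      ((n.factorial : ℝ)⁻¹) • iteratedFDeriv ℝ n f p fun _ => y - p) p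
        = iteratedFDeriv ℝ k f p := by
  set q : E → F := fun y => ∑ n ∈ Finset.range (b + 1),
      ((n.factorial : ℝ)⁻¹) • iteratedFDeriv ℝ n f p fun _ => y - p with hq
  let P : FormalMultilinearSeries ℝ E F := fun n =>
    if n < b + 1 then ((n.factorial : ℝ)⁻¹) • iteratedFDeriv ℝ n f p else 0
  have hP : HasFPowerSeriesOnBall q P p ⊤ := by
    have h1 := (FormalMultilinearSeries.hasFiniteFPowerSeriesOnBall_of_finite P (n := b + 1)
      (fun m hm => if_neg (not_lt.mpr hm))).toHasFPowerSeriesOnBall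
    have h2 := h1.comp_sub p
    rw [zero_add] at h2
    refine h2.congr fun y _ => ?_
    change P.sum (y - p) = q y
    rw [FormalMultilinearSeries.sum_of_finite (n := b + 1) P
      (fun m hm => if_neg (not_lt.mpr hm))]
    simp only [FormalMultilinearSeries.partialSum, hq]
    refine Finset.sum_congr rfl fun n hn => ?_
    simp only [P, if_pos (Finset.mem_range.mp hn), smul_apply]
  refine ⟨?_, fun k hk => ?_⟩
  · rw [hq]
    refine ContDiff.sum fun n _ => ContDiff.const_smul _ ?_
    exact (ContinuousMultilinearMap.contDiff _).comp
      (contDiff_pi.mpr fun _ => contDiff_id.sub contDiff_const)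
  · ext v
    -- The `k`-th derivative is the coefficient summed over all permutations of its arguments;
    -- symmetry makes this `k!` equal terms, cancelling the `1/k!` in the coefficient.
    rw [hP.iteratedFDeriv_eq_sum_of_completeSpace]
    have : ∀ σ : Equiv.Perm (Fin k), P k (fun i => v (σ i)) =
        ((k.factorial : ℝ)⁻¹) • iteratedFDeriv ℝ k f p v := by
      intro σ
      have := iteratedFDeriv_comp_perm hf p v σ
      simp only [P, Nat.lt_succ_of_le hk, if_true, smul_apply]
      rw [← this]; rfl
    simp only [this, Finset.sum_const, Finset.card_univ, Fintype.card_perm, Fintype.card_fin]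
    rw [← Nat.cast_smul_eq_nsmul ℝ, smul_smul, mul_inv_cancel₀ (by positivity), one_smul]

theorem iteratedDeriv_sum_pow_smul {ι : Type*} (s : Finset ι) (e : ι → ℕ) (a : ι → F) (b : ℕ) :
    ((b.factorial : ℝ)⁻¹) • iteratedDeriv b (fun ε : ℝ => ∑ i ∈ s, ε ^ e i • a i) 0 =
      ∑ i ∈ s with e i = b, a i := by
  rw [iteratedDeriv_fun_sum (fun i _ => by fun_prop), Finset.smul_sum, Finset.sum_filter]
  refine Finset.sum_congr rfl fun i _ => ?_
  have h1 : iteratedDeriv b (fun ε : ℝ => ε ^ e i • a i) 0 =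
      iteratedDeriv b (fun ε : ℝ => ε ^ e i) 0 • a i := by
    exact iteratedDeriv_smul_const (by fun_prop) _
  rw [h1, iteratedDeriv_fun_pow_zero]
  split_ifs with h2 h3 h3
  · rw [smul_smul, h3, inv_mul_cancel₀ (by positivity), one_smul]
  all_goals simp_all

/-- The Taylor coefficients of `f ∘ γ` for a polynomial curve `γ`. -/
theorem taylor_coeff_comp [CompleteSpace F] {ι : Type*} [DecidableEq ι] (I : Finset ι)
    (e : ι → ℕ) (he : ∀ i ∈ I, 1 ≤ e i) (v : ι → E) {f : E → F} (hf : ContDiff ℝ ∞ f) (p : E)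
    (b : ℕ) :
    ((b.factorial : ℝ)⁻¹) •
        iteratedDeriv b (fun ε : ℝ => f (p + ∑ i ∈ I, ε ^ e i • v i)) 0 =
      ∑ n ∈ Finset.range (b + 1), ((n.factorial : ℝ)⁻¹) •
        ∑ κ ∈ Fintype.piFinset (fun _ : Fin n => I) with ∑ j, e (κ j) = b,
          iteratedFDeriv ℝ n f p (v ∘ κ) := by
  obtain ⟨hq, hqf⟩ := exists_taylor_polynomial hf p b
  set q : E → F := fun y => ∑ n ∈ Finset.range (b + 1),
      ((n.factorial : ℝ)⁻¹) • iteratedFDeriv ℝ n f p fun _ => y - p with hqdef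
  set γ : ℝ → E := fun ε => p + ∑ i ∈ I, ε ^ e i • v i with hγdef
  have hγ : ContDiff ℝ ∞ γ := by
    rw [hγdef]; fun_prop
  have hγ0 : γ 0 = p := by
    rw [hγdef]
    simp only [add_eq_left]
    refine Finset.sum_eq_zero fun i hi => ?_
    rw [zero_pow (by have := he i hi; omega), zero_smul]
  -- Replacing `f` by its Taylor polynomial makes the composition a polynomial in `ε`, whose
  -- coefficients can be read off. All exponents are positive, so the curve starts at `p`.
  have h1 : iteratedDeriv b (fun ε : ℝ => f (p + ∑ i ∈ I, ε ^ e i • v i)) 0 =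
      iteratedDeriv b (q ∘ γ) 0 :=
    iteratedDeriv_comp_congr hf hq hγ.contDiffAt hγ.contDiffAt
      (fun k hk => by rw [show p + ∑ i ∈ I, (0 : ℝ) ^ e i • v i = p from hγ0, hqf k hk]) (fun _ _ => rfl)
  rw [h1]
  have h2 : q ∘ γ = fun ε => ∑ x ∈ (Finset.range (b + 1)).sigma
      (fun n => Fintype.piFinset (fun _ : Fin n => I)),
        ε ^ (∑ j, e (x.2 j)) • ((x.1.factorial : ℝ)⁻¹ • iteratedFDeriv ℝ x.1 f p (v ∘ x.2)) := by
    funext ε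
    rw [Finset.sum_sigma]
    simp only [hqdef, hγdef, Function.comp, add_sub_cancel_left]
    refine Finset.sum_congr rfl fun n _ => ?_
    rw [ContinuousMultilinearMap.map_sum_finset, Finset.smul_sum]
    refine Finset.sum_congr rfl fun κ _ => ?_
    rw [ContinuousMultilinearMap.map_smul_univ, smul_comm, Finset.prod_pow_eq_pow_sum]
    rfl
  rw [h2, iteratedDeriv_sum_pow_smul, Finset.sum_filter, Finset.sum_sigma]
  refine Finset.sum_congr rfl fun n _ => ?_
  rw [Finset.sum_filter, Finset.smul_sum]
  refine Finset.sum_congr rfl fun κ _ => ?_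
  split_ifs <;> simp

end Calculus

/-! ### Counting the words with a given multiset of letters -/

section Counting

theorem exists_map_univ_eq {α : Type*} {n : ℕ} (S : Multiset α) (hn : S.card = n) :
    ∃ κ : Fin n → α, Finset.univ.val.map κ = S := by
  subst hn
  induction S using Quotient.inductionOn with
  | _ l =>
    refine ⟨fun i => l.get (i.cast (by simp)), ?_⟩
    change (Finset.univ.val.map fun i : Fin l.length => l.get i) = _
    rw [Fin.univ_def]
    exact congrArg _ (List.map_get_finRange _)

/-- Orbit and stabiliser for the symmetric group permuting the positions of words: the words with
letter multiset `S` form one orbit, and the stabiliser of a word permutes equal letters among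
themselves. -/
theorem card_map_univ_eq_mul {α : Type*} [DecidableEq α] (I : Finset α) {n : ℕ} (S : Multiset α)
    (hS : ∀ a ∈ S, a ∈ I) (hn : S.card = n) :
    (Finset.card {κ ∈ Fintype.piFinset (fun _ : Fin n => I) | Finset.univ.val.map κ = S}) *
      ∏ a ∈ S.toFinset, (S.count a).factorial = n.factorial := by
  obtain ⟨κ₀, hκ₀⟩ : ∃ κ : Fin n → α, Finset.univ.val.map κ = S :=
    exists_map_univ_eq S hn
  set T : Finset (Fin n → α) :=
    {κ ∈ Fintype.piFinset (fun _ : Fin n => I) | Finset.univ.val.map κ = S} with hT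
  have hstab : Finset.card {σ : Equiv.Perm (Fin n) | κ₀ ∘ σ = κ₀} =
      ∏ a ∈ S.toFinset, (S.count a).factorial := by
    rw [← Fintype.card_subtype, DomMulAct.stabilizer_card']
    have : Finset.univ.image κ₀ = S.toFinset := by
      ext a; rw [← hκ₀]; simp
    rw [this]
    refine Finset.prod_congr rfl fun a _ => ?_
    rw [Fintype.card_subtype]
    conv_rhs => rw [← hκ₀, Multiset.count_map]
    simp [Finset.card, eq_comm]
  have hmaps : ∀ σ ∈ (Finset.univ : Finset (Equiv.Perm (Fin n))), κ₀ ∘ σ ∈ T := by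
    intro σ _
    have h2 : Finset.univ.val.map (κ₀ ∘ σ) = S := by
      rw [← Multiset.map_map, Multiset.map_univ_val_equiv, hκ₀]
    refine Finset.mem_filter.mpr ⟨Fintype.mem_piFinset.mpr fun i => hS _ ?_, h2⟩
    rw [← h2]
    exact Multiset.mem_map_of_mem _ (Finset.mem_univ i)
  have hcard := Finset.card_eq_sum_card_fiberwise hmaps
  rw [Finset.card_univ, Fintype.card_perm, Fintype.card_fin] at hcard
  rw [hcard, ← hstab, ← smul_eq_mul, ← Finset.sum_const]
  refine Finset.sum_congr rfl fun κ hκ => ?_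
  -- The permutations carrying `κ₀` to `κ` form a coset of the stabiliser, via right multiplication
  -- by `ρ`.
  obtain ⟨ρ, hρ⟩ := Tree.exists_equiv_of_map_eq κ κ₀ ((Finset.mem_filter.mp hκ).2.trans hκ₀.symm)
  refine Finset.card_equiv (Equiv.mulRight ρ) fun σ => ?_
  simp only [Finset.mem_filter, Finset.mem_univ, true_and, Equiv.coe_mulRight, Equiv.Perm.coe_mul]
  have hρ' : κ = κ₀ ∘ ρ := funext hρ
  rw [hρ', ← Function.comp_assoc]
  exact (ρ.surjective.injective_comp_right.eq_iff).symm

end Counting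

/-! ### The structure of the trees in `T` and their splittings -/

section Trees

variable {M : ℕ}

namespace Tree

theorem ofPre_node (l : Label M) (n : ℕ) (u : Fin n → PreTree M) :
    ofPre (PreTree.node l n u) = bracket l (Finset.univ.val.map fun i => ofPre (u i)) :=
  eq_of_root_children rfl (children_bracket _ _).symm

theorem ofPre_node_repr (l : Label M) {n : ℕ} (κ : Fin n → Tree M) :
    ofPre (PreTree.node l n fun i => (κ i).repr) = bracket l (Finset.univ.val.map κ) := by
  rw [ofPre_node]
  simp only [ofPre_repr]

theorem bracket_inj {l l' : Label M} {S S' : Multiset (Tree M)} :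
    bracket l S = bracket l' S' ↔ l = l' ∧ S = S' := by
  constructor
  · intro h
    exact ⟨by simpa [root_bracket] using congrArg root h,
      by simpa [children_bracket] using congrArg children h⟩
  · rintro ⟨rfl, rfl⟩; rfl

theorem size_bracket (l : Label M) (S : Multiset (Tree M)) :
    (bracket l S).size = 1 + (S.map size).sum := by
  obtain ⟨n, hn⟩ : ∃ n, S.card = n := ⟨_, rfl⟩
  obtain ⟨κ, rfl⟩ := exists_map_univ_eq S hn
  rw [← ofPre_node_repr]
  change (PreTree.node l _ fun i => (κ i).repr).size = _
  rw [PreTree.size, Multiset.map_map]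
  congr 1
  refine Finset.sum_congr rfl fun i _ => ?_
  conv_rhs => rw [Function.comp, ← ofPre_repr (κ i)]
  rfl

open Classical in
theorem alpha_bracket (l : Label M) (S : Multiset (Tree M)) :
    (bracket l S).alpha =
      (S.map alpha).prod / ((∏ σ ∈ S.toFinset, Nat.factorial (S.count σ) : ℕ) : ℝ) := by
  conv_rhs => rw [← children_bracket l S]
  obtain ⟨n, hn⟩ : ∃ n, S.card = n := ⟨_, rfl⟩
  obtain ⟨κ, rfl⟩ := exists_map_univ_eq S hn
  rw [← ofPre_node_repr]
  change (PreTree.node l _ fun i => (κ i).repr).alpha = _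
  rw [PreTree.alpha]
  congr 1
  change _ = ((Finset.univ.val.map fun i => ofPre (κ i).repr).map alpha).prod
  rw [Multiset.map_map]
  rfl

theorem one_le_size (τ : Tree M) : 1 ≤ τ.size := by
  rw [← bracket_root_children τ, size_bracket]
  omega

theorem size_lt_of_mem {τ σ : Tree M} (h : σ ∈ τ.children) : σ.size < τ.size := by
  conv_rhs => rw [← bracket_root_children τ, size_bracket]
  have := Multiset.single_le_sum (fun _ _ => Nat.zero_le _) _ (Multiset.mem_map_of_mem size h)
  omega

theorem induction {P : Tree M → Prop}
    (h : ∀ l S, (∀ σ ∈ S, P σ) → P (bracket l S)) (τ : Tree M) : P τ := by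
  induction hn : τ.size using Nat.strong_induction_on generalizing τ with
  | _ n ih =>
    subst hn
    rw [← bracket_root_children τ]
    exact h _ _ fun σ hσ => ih _ (size_lt_of_mem hσ) σ rfl

theorem leaf_root (l : Label M) : (leaf l).root = l := rfl

theorem alpha_leaf (l : Label M) : (leaf l).alpha = 1 := by
  simp [leaf, alpha_bracket]

theorem size_leaf (l : Label M) : (leaf l).size = 1 := by
  simp [leaf, size_bracket]

theorem children_leaf (l : Label M) : (leaf l).children = 0 := children_bracket _ _

theorem finite_size_le (n : ℕ) : {τ : Tree M | τ.size ≤ n}.Finite := by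
  induction n with
  | zero =>
    refine Set.Finite.subset Set.finite_empty fun τ (hτ : τ.size ≤ 0) => ?_
    have := one_le_size τ
    omega
  | succ n ih =>
    classical
    have hl : (Set.univ : Set (Label M)).Finite := by
      refine (((Set.finite_univ (α := Fin (M + 1))).image Label.g).union
        (Set.toFinite {Label.A, Label.t})).subset fun l _ => ?_
      cases l <;> simp
    -- With at most `n + 1` nodes there are at most `n` branches, each with at most `n` nodes, so
    -- the multiset of branches lies below `n` copies of the finite set of such trees.
    refine (Set.Finite.image2 bracket hl (Set.finite_Iic (n • ih.toFinset.val))).subset ?_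
    intro τ (hτ : τ.size ≤ n + 1)
    refine ⟨τ.root, Set.mem_univ _, τ.children, ?_, bracket_root_children τ⟩
    rw [Set.mem_Iic, Multiset.le_iff_count]
    intro σ
    by_cases hσ : σ ∈ τ.children
    · have h1 : τ.children.card ≤ n := by
        rw [← bracket_root_children τ, size_bracket] at hτ
        have : τ.children.card • 1 ≤ (τ.children.map size).sum := by
          have := Multiset.card_nsmul_le_sum (s := τ.children.map size) (a := 1) (by
            intro x hx
            obtain ⟨σ, _, rfl⟩ := Multiset.mem_map.mp hx
            exact one_le_size σ)
          simpa using this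
        simp at this
        omega
      have h2 : σ ∈ ih.toFinset := by
        have := size_lt_of_mem hσ
        simp only [Set.Finite.mem_toFinset, Set.mem_ofPred_eq]
        omega
      rw [Multiset.count_nsmul, Multiset.count_eq_one_of_mem ih.toFinset.nodup h2]
      have := Multiset.count_le_card σ τ.children
      omega
    · rw [Multiset.count_eq_zero_of_notMem hσ]; exact Nat.zero_le _

end Tree

open BSeriesERK.Tree

theorem finite_size_eq (𝒯 : Set (Option (Tree M))) (n : ℕ) : {τ | τ ∈ 𝒯 ∧ size τ = n}.Finite := by
  refine ((finite_size_le (M := M) n).image some |>.insert none).subset ?_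
  rintro (_ | τ) ⟨_, h⟩
  · simp
  · right
    exact ⟨τ, le_of_eq h, rfl⟩

theorem InT.root_ne_t {τ : Tree M} (h : InT τ) : τ.root ≠ Label.t := by
  cases h <;> simp [root_bracket, Tree.leaf]

theorem InT.ne_leaf_t {τ : Tree M} (h : InT τ) : τ ≠ leaf Label.t := by
  rintro rfl; exact h.root_ne_t rfl

theorem InT.children_mem {τ : Tree M} (h : InT τ) {m : Fin (M + 1)} (hr : τ.root = Label.g m)
    {σ : Tree M} (hσ : σ ∈ τ.children) (hne : σ ≠ leaf Label.t) : InT σ := by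
  cases h with
  | g m S hS => rw [children_bracket] at hσ; exact hS _ hσ hne
  | leafA => cases hr
  | A σ n h => cases hr

theorem GFree.inv {τ : Tree M} (h : GFree τ) :
    (∀ m, τ.root ≠ Label.g m) ∧ ∀ σ ∈ τ.children, GFree σ := by
  cases h with
  | mk l S hl hS => exact ⟨hl, by rwa [children_bracket]⟩

theorem gFree_leaf_t : GFree (leaf Label.t : Tree M) :=
  GFree.mk _ _ (by simp) (by simp)

theorem IsST.inv {τ : Tree M} {ϑ : Option (Tree M)} {R : Multiset (Tree M)} (h : IsST τ ϑ R) :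
    (ϑ = none ∧ R = {τ}) ∨
    ∃ L : Multiset (Tree M × Option (Tree M) × Multiset (Tree M)),
      (∀ p ∈ L, IsST p.1 p.2.1 p.2.2) ∧ τ.children = L.map (fun p => p.1) ∧
      ϑ = some (bracket τ.root (L.filterMap fun p => p.2.1)) ∧
      R = (L.map fun p => p.2.2).sum := by
  cases h with
  | cut => exact Or.inl ⟨rfl, rfl⟩
  | keep l L hL =>
    exact Or.inr ⟨L, hL, by rw [children_bracket], by rw [root_bracket], rfl⟩

theorem isST_self (τ : Tree M) : IsST τ (some τ) 0 := by
  induction τ using Tree.induction with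
  | h l S ih =>
    have := IsST.keep l (S.map fun σ => (σ, some σ, 0)) (by
      intro p hp
      obtain ⟨σ, hσ, rfl⟩ := Multiset.mem_map.mp hp
      exact ih σ hσ)
    simpa [Multiset.filterMap_map, Function.comp_def, Multiset.map_const'] using this

theorem multiset_filterMap_eq_map {α β : Type*} {f : α → Option β} {g : α → β} (L : Multiset α)
    (h : ∀ p ∈ L, f p = some (g p)) : L.filterMap f = L.map g := by
  induction L using Multiset.induction with
  | empty => rfl
  | cons a L ih =>
    rw [Multiset.filterMap_cons_some f _ _ (h a (by simp)), Multiset.map_cons,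
      ih fun p hp => h p (by simp [hp])]

theorem multiset_filterMap_cons {α β : Type*} (f : α → Option β) (a : α) (L : Multiset α) :
    (a ::ₘ L).filterMap f = (f a).elim 0 (fun b => {b}) + L.filterMap f := by
  cases h : f a with
  | none => rw [Multiset.filterMap_cons_none _ _ h]; simp
  | some b => rw [Multiset.filterMap_cons_some _ _ _ h]; simp

/-- An empty remainder leaves no room for a cut at any level; cutting the whole tree would leave a
singleton. -/
theorem IsST.eq_some_of_zero (τ : Tree M) : ∀ {ϑ : Option (Tree M)}, IsST τ ϑ 0 → ϑ = some τ := by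
  induction τ using Tree.induction with
  | h l S ih =>
    intro ϑ h
    obtain ⟨_, h⟩ | ⟨L, hL, hc, rfl, hR⟩ := h.inv
    · simp at h
    · rw [children_bracket] at hc
      subst hc
      rw [root_bracket]
      congr 2
      refine multiset_filterMap_eq_map L fun p hp => ?_
      refine ih p.1 (Multiset.mem_map_of_mem _ hp) ?_
      have h0 : p.2.2 = 0 :=
        Multiset.sum_eq_zero_iff.mp hR.symm _ (Multiset.mem_map_of_mem _ hp)
      exact h0 ▸ hL p hp

/-- `graft [n₁,…,n_k] δ` is `[… [δ, •_t^{n_k}]_A …, •_t^{n₁}]_A`. -/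
noncomputable def graft : List ℕ → Tree M → Tree M
  | [], δ => δ
  | n :: l, δ => bracket Label.A (graft l δ ::ₘ Multiset.replicate n (leaf Label.t))

/-- `chain [n₁,…,n_k]` is the tree `[… [•_t^{n_k}]_A …, •_t^{n₁}]_A`. -/
noncomputable def chain : List ℕ → Option (Tree M)
  | [] => none
  | n :: l => some (bracket Label.A
      ((chain l).elim 0 (fun σ => {σ}) + Multiset.replicate n (leaf Label.t)))

/-- The root is some `g m`. -/
def GRoot (δ : Tree M) : Prop := ∃ m, δ.root = Label.g m

theorem graft_root_ne_t (l : List ℕ) {δ : Tree M} (h : GRoot δ) : graft l δ ≠ leaf Label.t := by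
  intro h'
  have := congrArg root h'
  cases l with
  | nil => obtain ⟨m, hm⟩ := h; simp [graft, hm, leaf_root] at this
  | cons n l => simp [graft, root_bracket, leaf_root] at this

theorem chain_ne_t (l : List ℕ) : chain l ≠ some (leaf Label.t : Tree M) := by
  intro h'
  cases l with
  | nil => simp [chain] at h'
  | cons n l =>
    have := congrArg root (Option.some.inj h')
    simp [root_bracket, leaf_root] at this

theorem size_graft (l : List ℕ) (δ : Tree M) :
    (graft l δ).size = size (chain l : Option (Tree M)) + δ.size := by
  induction l with
  | nil => simp [graft, chain, size]
  | cons n l ih =>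
    cases h : (chain l : Option (Tree M)) <;>
    simp [graft, chain, size, size_bracket, ih, h, size_leaf] <;> omega

theorem gFree_chain (l : List ℕ) : ∀ σ ∈ (chain l : Option (Tree M)), GFree σ := by
  induction l with
  | nil => simp [chain]
  | cons n l ih =>
    rintro σ hσ
    obtain rfl := Option.some.inj hσ
    refine GFree.mk _ _ (by simp) ?_
    intro σ hσ
    rw [Multiset.mem_add] at hσ
    obtain h | h := hσ
    · cases hc : (chain l : Option (Tree M)) with
      | none => simp [hc] at h
      | some ρ =>
        simp only [hc, Option.elim_some, Multiset.mem_singleton] at h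
        subst h
        exact ih _ hc
    · rw [Multiset.eq_of_mem_replicate h]; exact gFree_leaf_t

theorem chain_mem (l : List ℕ) : chain l ∈ treesTA M := by
  suffices h : ∀ σ ∈ (chain l : Option (Tree M)), InT σ from
    fun σ hσ => ⟨h σ hσ, gFree_chain l σ hσ⟩
  induction l with
  | nil => simp [chain]
  | cons n l ih =>
    rintro σ hσ
    obtain rfl := Option.some.inj hσ
    cases hc : (chain l : Option (Tree M)) with
    | none =>
      cases n with
      | zero => simpa [leaf] using InT.leafA (M := M)
      | succ n =>
        simpa [Multiset.replicate_succ] using InT.A (leaf Label.t : Tree M) n (by simp)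
    | some ρ => simpa using InT.A ρ n fun _ => ih ρ hc

theorem graft_mem (l : List ℕ) {δ : Tree M} (h : InT δ) : InT (graft l δ) := by
  induction l with
  | nil => exact h
  | cons n l ih => exact InT.A _ _ fun _ => ih

theorem graft_not_gFree (l : List ℕ) {δ : Tree M} (h : GRoot δ) : ¬ GFree (graft l δ) := by
  induction l with
  | nil => obtain ⟨m, hm⟩ := h; exact fun h' => h'.inv.1 m hm
  | cons n l ih =>
    intro h'
    refine ih (h'.inv.2 _ ?_)
    rw [graft, children_bracket]
    simp

/-- The multiplicity of `•_t` recovers `n`, because the optional special branch is not `•_t`;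
cancelling these leaves then recovers that branch. -/
theorem replicate_leaf_inj {n n' : ℕ} {x x' : Option (Tree M)} (hx : x ≠ some (leaf Label.t))
    (hx' : x' ≠ some (leaf Label.t))
    (h : x.elim 0 (fun σ => {σ}) + Multiset.replicate n (leaf Label.t) =
      x'.elim 0 (fun σ => {σ}) + Multiset.replicate n' (leaf Label.t)) : n = n' ∧ x = x' := by
  classical
  have hcount : ∀ y : Option (Tree M), y ≠ some (leaf Label.t) →
      (y.elim 0 (fun σ => {σ}) : Multiset (Tree M)).count (leaf Label.t) = 0 := by
    rintro (_ | σ) hy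
    · simp
    · simp only [Option.elim_some]
      exact Multiset.count_eq_zero_of_notMem (by simpa [eq_comm] using hy)
  have hn := congrArg (Multiset.count (leaf Label.t)) h
  rw [Multiset.count_add, Multiset.count_add, hcount x hx, hcount x' hx'] at hn
  simp only [Multiset.count_replicate_self, zero_add] at hn
  subst hn
  refine ⟨rfl, ?_⟩
  have h' := add_right_cancel h
  cases x <;> cases x' <;> simp_all

theorem chain_injective : Function.Injective (chain : List ℕ → Option (Tree M)) := by
  intro l
  induction l with
  | nil => rintro (_ | ⟨n', l'⟩) h <;> simp_all [chain]
  | cons n l ih =>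
    rintro (_ | ⟨n', l'⟩) h
    · simp [chain] at h
    · simp only [chain, Option.some.injEq, bracket_inj, true_and] at h
      obtain ⟨rfl, h'⟩ := replicate_leaf_inj (chain_ne_t l) (chain_ne_t l') h
      rw [ih h']

theorem graft_injective {l l' : List ℕ} {δ δ' : Tree M} (hδ : GRoot δ) (hδ' : GRoot δ')
    (h : graft l δ = graft l' δ') : l = l' ∧ δ = δ' := by
  induction l generalizing l' with
  | nil =>
    obtain ⟨m, hm⟩ := hδ
    cases l' with
    | nil => exact ⟨rfl, h⟩
    | cons n' l' =>
      have := congrArg root h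
      simp [graft, hm, root_bracket] at this
  | cons n l ih =>
    cases l' with
    | nil =>
      obtain ⟨m, hm⟩ := hδ'
      have := congrArg root h
      simp [graft, hm, root_bracket] at this
    | cons n' l' =>
      simp only [graft, bracket_inj, true_and] at h
      have := replicate_leaf_inj (n := n) (n' := n') (x := some (graft l δ))
        (x' := some (graft l' δ')) (by simpa using graft_root_ne_t l hδ)
        (by simpa using graft_root_ne_t l' hδ') (by simpa using h)
      obtain ⟨rfl, h'⟩ := this
      obtain ⟨rfl, rfl⟩ := ih (Option.some.inj h')
      exact ⟨rfl, rfl⟩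

/-- The descent through the `A` nodes. A root `A` with `•_t` as its distinguished branch ends the
chain with that leaf counted among the others, hence `n + 1`. -/
theorem InT.cases_chain {τ : Tree M} (h : InT τ) :
    (∃ l, some τ = chain l) ∨ ∃ l δ, δ ∈ treesTg M ∧ τ = graft l δ := by
  induction h with
  | g m S hS _ => exact Or.inr ⟨[], _, ⟨InT.g m S hS, m, rfl⟩, rfl⟩
  | leafA => exact Or.inl ⟨[0], by simp [chain, leaf]⟩
  | A σ n hσ ih =>
    by_cases ht : σ = leaf Label.t
    · subst ht
      exact Or.inl ⟨[n + 1], by simp [chain, Multiset.replicate_succ]⟩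
    · obtain ⟨l, hl⟩ | ⟨l, δ, hδ, rfl⟩ := ih ht
      · exact Or.inl ⟨n :: l, by simp [chain, ← hl]⟩
      · exact Or.inr ⟨n :: l, δ, hδ, rfl⟩

theorem mem_treesTA_iff {τ : Option (Tree M)} : τ ∈ treesTA M ↔ ∃ l, τ = chain l := by
  constructor
  · intro h
    cases τ with
    | none => exact ⟨[], rfl⟩
    | some τ =>
      obtain h' | ⟨l, δ, hδ, rfl⟩ := (h τ rfl).1.cases_chain
      · exact h'
      · exact absurd (h _ rfl).2 (graft_not_gFree l hδ.2)
  · rintro ⟨l, rfl⟩; exact chain_mem l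

theorem some_notMem_treesTA_iff {τ : Tree M} (hτ : some τ ∈ treesT M) :
    some τ ∉ treesTA M ↔ ∃ l δ, δ ∈ treesTg M ∧ τ = graft l δ := by
  constructor
  · intro h
    obtain ⟨l, hl⟩ | h' := (hτ τ rfl).cases_chain
    · exact absurd (hl ▸ chain_mem l) h
    · exact h'
  · rintro ⟨l, δ, hδ, rfl⟩ h
    exact graft_not_gFree l hδ.2 (h _ rfl).2

theorem chain_mem_SP (l : List ℕ) (δ : Tree M) : (chain l, δ) ∈ SP (graft l δ) := by
  change IsST (graft l δ) (chain l) {δ}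
  induction l with
  | nil => exact IsST.cut δ
  | cons n l ih =>
    have := IsST.keep Label.A ((graft l δ, chain l, {δ}) ::ₘ
      Multiset.replicate n (leaf Label.t, some (leaf Label.t), 0)) (by
        intro p hp
        rw [Multiset.mem_cons] at hp
        obtain rfl | hp := hp
        · exact ih
        · rw [Multiset.eq_of_mem_replicate hp]; exact isST_self _)
    have h2 : ((graft l δ, chain l, {δ}) ::ₘ
      Multiset.replicate n ((leaf Label.t : Tree M), some (leaf Label.t : Tree M),
        (0 : Multiset (Tree M)))).filterMap (fun p => p.2.1) =
        (chain l).elim 0 (fun σ => {σ}) + Multiset.replicate n (leaf Label.t) := by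
      have h3 : (Multiset.replicate n ((leaf Label.t : Tree M), some (leaf Label.t : Tree M),
        (0 : Multiset (Tree M)))).filterMap (fun p => p.2.1) =
          Multiset.replicate n (leaf Label.t) := by
        rw [multiset_filterMap_eq_map (g := fun _ => leaf Label.t), Multiset.map_const',
          Multiset.card_replicate]
        intro p hp
        rw [Multiset.eq_of_mem_replicate hp]
      rw [multiset_filterMap_cons, h3]
    rw [h2] at this
    simpa [graft, chain] using this

/-- No `g` node may survive in `ϑ`, so the cut cannot lie strictly inside `δ`; the piece cut off has
a `g` root, so the cut cannot be at an `A` node or at a leaf `•_t`. Only the cut at the root of `δ`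
remains. -/
theorem SP_unique (l : List ℕ) {δ δ' : Tree M} {ϑ : Option (Tree M)} (hδ : GRoot δ)
    (hδ' : GRoot δ') (hϑ : ∀ σ ∈ ϑ, GFree σ) (h : IsST (graft l δ) ϑ {δ'}) :
    ϑ = chain l ∧ δ' = δ := by
  induction l generalizing ϑ with
  | nil =>
    obtain ⟨rfl, h1⟩ | ⟨L, hL, hc, rfl, hR⟩ := h.inv
    · exact ⟨rfl, Multiset.singleton_inj.mp h1⟩
    · obtain ⟨m, hm⟩ := hδ
      exact absurd hm ((hϑ _ rfl).inv.1 m)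
  | cons n l ih =>
    obtain ⟨rfl, h1⟩ | ⟨L, hL, hc, rfl, hR⟩ := h.inv
    · obtain ⟨m, hm⟩ := hδ'
      replace h1 := Multiset.singleton_inj.mp h1
      simp [h1, graft, root_bracket] at hm
    · classical
      rw [graft, children_bracket] at hc
      -- `p` records how the branch `graft l δ` is split; all entries of `L'` belong to leaves
      -- `•_t`.
      obtain ⟨p, hp, hp1, hc'⟩ := (Multiset.map_eq_cons _ _ _ _).mpr hc.symm
      have hL' := Multiset.cons_erase hp
      set L' := L.erase p
      rw [← hL'] at hL hR hϑ ⊢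
      have hleaf : ∀ q ∈ L', q.1 = leaf Label.t := fun q hq =>
        Multiset.eq_of_mem_replicate (hc' ▸ Multiset.mem_map_of_mem _ hq)
      rw [Multiset.map_cons, Multiset.sum_cons] at hR
      have hnot : δ' ∉ (L'.map fun q => q.2.2).sum := by
        intro hmem
        obtain ⟨q, hq, hmem⟩ := Multiset.mem_bind.mp hmem
        have hq' := hL q (Multiset.mem_cons_of_mem hq)
        rw [hleaf q hq] at hq'
        obtain ⟨m, hm⟩ := hδ'
        obtain ⟨_, h⟩ | ⟨K, _, hK, _, h⟩ := hq'.inv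
        · rw [h, Multiset.mem_singleton] at hmem
          simp [hmem, leaf_root] at hm
        · rw [children_leaf, eq_comm, Multiset.map_eq_zero] at hK
          simp [h, hK] at hmem
      -- The single cut piece comes from `p`, so every leaf is kept whole.
      have hpR : p.2.2 = {δ'} ∧ (L'.map fun q => q.2.2).sum = 0 := by
        have hmem : δ' ∈ p.2.2 := by
          have : δ' ∈ p.2.2 + (L'.map fun q => q.2.2).sum := by rw [← hR]; simp
          exact (Multiset.mem_add.mp this).resolve_right hnot
        obtain ⟨r, hr⟩ := Multiset.exists_cons_of_mem hmem
        rw [hr, Multiset.cons_add, ← Multiset.cons_zero, Multiset.cons_inj_right, eq_comm,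
          add_eq_zero] at hR
        rw [hr, hR.1]
        exact ⟨rfl, hR.2⟩
      have hpST := hL p (Multiset.mem_cons_self _ _)
      rw [hp1, hpR.1] at hpST
      have hkeep : L'.filterMap (fun q => q.2.1) = Multiset.replicate n (leaf Label.t) := by
        rw [← hc']
        refine multiset_filterMap_eq_map L' fun q hq => IsST.eq_some_of_zero _ ?_
        have h0 : q.2.2 = 0 :=
          Multiset.sum_eq_zero_iff.mp hpR.2 _ (Multiset.mem_map_of_mem _ hq)
        exact h0 ▸ hL q (Multiset.mem_cons_of_mem hq)
      have hfm : (p ::ₘ L').filterMap (fun q => q.2.1) =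
          p.2.1.elim 0 (fun σ => {σ}) + Multiset.replicate n (leaf Label.t) := by
        rw [multiset_filterMap_cons, hkeep]
      obtain ⟨h1, h2⟩ := ih (ϑ := p.2.1) (by
        intro σ hσ
        refine (hϑ _ rfl).inv.2 σ ?_
        rw [children_bracket, hfm, hσ]
        simp) hpST
      refine ⟨?_, h2⟩
      rw [hfm, h1]
      rfl

theorem existsUnique_splitting {τ : Tree M} (hτ : some τ ∈ treesT M) (hA : some τ ∉ treesTA M) :
    ∃! p : Option (Tree M) × Tree M, p ∈ SP τ ∧ p.1 ∈ treesTA M ∧ p.2 ∈ treesTg M := by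
  obtain ⟨l, δ, hδ, rfl⟩ := (some_notMem_treesTA_iff hτ).mp hA
  refine ⟨(chain l, δ), ⟨chain_mem_SP l δ, chain_mem l, hδ⟩, ?_⟩
  rintro ⟨ϑ, δ'⟩ ⟨h, hϑ, hδ'⟩
  obtain ⟨h1, h2⟩ := SP_unique l hδ.2 hδ'.2 (fun σ hσ => (hϑ σ hσ).2) h
  exact Prod.ext h1 h2

end Trees
-- The recursion for the weights: existence, uniqueness, measurability
section Weights

variable {M s : ℕ}

open BSeriesERK.Tree

theorem compWeight_congr (m : Fin (M + 1)) {φ ψ : Option (Tree M) → ℝ} {δ : Tree M}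
    (h : ∀ σ ∈ δ.children, φ (some σ) = ψ (some σ)) :
    compWeight m φ (some δ) = compWeight m ψ (some δ) := by
  simp only [compWeight]
  rw [Multiset.map_congr rfl h]

theorem compWeight_of_root (m : Fin (M + 1)) (φ : Option (Tree M) → ℝ) {δ : Tree M}
    (h : δ.root = Label.g m) :
    compWeight m φ (some δ) = (δ.children.map fun σ => φ (some σ)).prod := by
  simp [compWeight, h]

theorem compWeight_of_root_ne (m : Fin (M + 1)) (φ : Option (Tree M) → ℝ) {δ : Tree M}
    (h : δ.root ≠ Label.g m) : compWeight m φ (some δ) = 0 := by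
  simp [compWeight, h]

/-- Summing over all `m'` mirrors the shape of the method; only the label of the root contributes,
which gives back the recursion. -/
theorem sum_mul_compWeight (z : Fin (M + 1) → Fin s → ℝ) (φ : Fin s → Option (Tree M) → ℝ)
    (m : Fin (M + 1)) (S : Multiset (Tree M)) :
    ∑ m', ∑ j, z m' j * compWeight m' (φ j) (some (bracket (Label.g m) S)) =
      ∑ j, z m j * (S.map fun σ => φ j (some σ)).prod := by
  rw [Finset.sum_eq_single m]
  · simp only [compWeight_of_root m _ (root_bracket _ _), children_bracket]
  · intro m' _ hm'
    refine Finset.sum_eq_zero fun j _ => ?_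
    rw [compWeight_of_root_ne, mul_zero]
    rw [root_bracket]
    exact fun h => hm' (Label.g.inj h).symm
  · simp

/-- `φ'` are the weights of one line of the method, whose coefficients have the weights `z₀`, `z`,
for stage values with the weights `φ`. -/
structure IsLine (z₀ : Option (Tree M) → ℝ) (z : Fin (M + 1) → Fin s → Option (Tree M) → ℝ)
    (φ : Fin s → Option (Tree M) → ℝ) (φ' : Option (Tree M) → ℝ) : Prop where
  chain_eq : ∀ l, φ' (chain l) = z₀ (chain l)
  graft_eq : ∀ l, ∀ δ ∈ treesTg M, φ' (some (graft l δ)) =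
    ∑ m, ∑ j, z m j (chain l) * compWeight m (φ j) (some δ)

open Classical in
/-- The weights of a line of the method for stage values with the weights `φ`. -/
noncomputable def lineWeight (z₀ : Option (Tree M) → ℝ)
    (z : Fin (M + 1) → Fin s → Option (Tree M) → ℝ) (φ : Fin s → Option (Tree M) → ℝ)
    (τ : Option (Tree M)) : ℝ :=
  if h : ∃ p : List ℕ × Tree M, p.2 ∈ treesTg M ∧ τ = some (graft p.1 p.2) then
    ∑ m, ∑ j, z m j (chain h.choose.1) * compWeight m (φ j) (some h.choose.2)
  else z₀ τ

theorem lineWeight_graft (z₀ : Option (Tree M) → ℝ)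
    (z : Fin (M + 1) → Fin s → Option (Tree M) → ℝ) (φ : Fin s → Option (Tree M) → ℝ)
    (l : List ℕ) {δ : Tree M} (hδ : δ ∈ treesTg M) :
    lineWeight z₀ z φ (some (graft l δ)) =
      ∑ m, ∑ j, z m j (chain l) * compWeight m (φ j) (some δ) := by
  have h : ∃ p : List ℕ × Tree M, p.2 ∈ treesTg M ∧ some (graft l δ) = some (graft p.1 p.2) :=
    ⟨(l, δ), hδ, rfl⟩
  rw [lineWeight, dif_pos h]
  -- Uniqueness of the decomposition identifies the chosen pair with `(l, δ)`.
  obtain ⟨h1, h2⟩ := graft_injective hδ.2 h.choose_spec.1.2 (Option.some.inj h.choose_spec.2)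
  rw [← h1, ← h2]

theorem lineWeight_of_forall_ne (z₀ : Option (Tree M) → ℝ)
    (z : Fin (M + 1) → Fin s → Option (Tree M) → ℝ) (φ : Fin s → Option (Tree M) → ℝ)
    {τ : Option (Tree M)} (hτ : ∀ l, ∀ δ ∈ treesTg M, τ ≠ some (graft l δ)) :
    lineWeight z₀ z φ τ = z₀ τ := by
  rw [lineWeight, dif_neg]
  rintro ⟨⟨l, δ⟩, hδ, h⟩
  exact hτ l δ hδ h

theorem chain_ne_graft (l l' : List ℕ) {δ : Tree M} (hδ : δ ∈ treesTg M) :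
    chain l ≠ some (graft l' δ) := fun h =>
  graft_not_gFree l' hδ.2 (gFree_chain l _ h)

theorem isLine_lineWeight (z₀ : Option (Tree M) → ℝ)
    (z : Fin (M + 1) → Fin s → Option (Tree M) → ℝ) (φ : Fin s → Option (Tree M) → ℝ) :
    IsLine z₀ z φ (lineWeight z₀ z φ) where
  chain_eq l := lineWeight_of_forall_ne _ _ _ fun l' _ hδ => chain_ne_graft l l' hδ
  graft_eq l _ hδ := lineWeight_graft _ _ _ l hδ

theorem size_lt_size_graft (l : List ℕ) {δ σ : Tree M} (hσ : σ ∈ δ.children) :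
    σ.size < (graft l δ).size := by
  have := size_lt_of_mem hσ
  rw [size_graft]
  omega

/-- Only branches of `δ` enter, and these have fewer nodes than the tree. This makes the iteration
for the stage weights stabilise. -/
theorem lineWeight_congr (z₀ : Option (Tree M) → ℝ)
    (z : Fin (M + 1) → Fin s → Option (Tree M) → ℝ) {φ ψ : Fin s → Option (Tree M) → ℝ}
    {τ : Option (Tree M)} (h : ∀ j σ, σ.size < size τ → φ j (some σ) = ψ j (some σ)) :
    lineWeight z₀ z φ τ = lineWeight z₀ z ψ τ := by
  by_cases hτ : ∃ l, ∃ δ ∈ treesTg M, τ = some (graft l δ)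
  · obtain ⟨l, δ, hδ, rfl⟩ := hτ
    rw [lineWeight_graft _ _ _ _ hδ, lineWeight_graft _ _ _ _ hδ]
    refine Finset.sum_congr rfl fun m _ => Finset.sum_congr rfl fun j _ => ?_
    rw [compWeight_congr m fun σ hσ => h j σ (size_lt_size_graft l hσ)]
  · push Not at hτ
    rw [lineWeight_of_forall_ne _ _ _ hτ, lineWeight_of_forall_ne _ _ _ hτ]

open Classical in
/-- Iterates of the recursion for the weights of the stage values. -/
noncomputable def stageIter (r : Fin s → ℝ) (z₀ : Fin s → Option (Tree M) → ℝ)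
    (z : Fin (M + 1) → Fin s → Fin s → Option (Tree M) → ℝ) :
    ℕ → Fin s → Option (Tree M) → ℝ
  | 0 => fun _ _ => 0
  | n + 1 => fun i τ => if τ = some (leaf Label.t) then r i else
      lineWeight (z₀ i) (fun m j => z m i j) (stageIter r z₀ z n) τ

/-- The weights of the stage values, with the value `r` at the tree `•_t`. -/
noncomputable def stageWeight (r : Fin s → ℝ) (z₀ : Fin s → Option (Tree M) → ℝ)
    (z : Fin (M + 1) → Fin s → Fin s → Option (Tree M) → ℝ) (i : Fin s) (τ : Option (Tree M)) :
    ℝ :=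
  stageIter r z₀ z (size τ + 1) i τ

theorem stageIter_eq (r : Fin s → ℝ) (z₀ : Fin s → Option (Tree M) → ℝ)
    (z : Fin (M + 1) → Fin s → Fin s → Option (Tree M) → ℝ) (n n' : ℕ) (i : Fin s)
    (τ : Option (Tree M)) (h : size τ < n) (h' : size τ < n') :
    stageIter r z₀ z n i τ = stageIter r z₀ z n' i τ := by
  induction n generalizing n' i τ with
  | zero => omega
  | succ n ih =>
    obtain _ | n' := n'
    · omega
    · simp only [stageIter]
      split_ifs
      · rfl
      · exact lineWeight_congr _ _ fun j σ hσ =>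
          ih n' j (some σ) (by simp only [size]; omega) (by simp only [size]; omega)

theorem stageWeight_time (r : Fin s → ℝ) (z₀ : Fin s → Option (Tree M) → ℝ)
    (z : Fin (M + 1) → Fin s → Fin s → Option (Tree M) → ℝ) (i : Fin s) :
    stageWeight r z₀ z i (some (leaf Label.t)) = r i := by
  simp [stageWeight, stageIter]

/-- The fixed-point equation. The tree `•_t` is excluded because it is not in `T` and its weight is
prescribed separately. -/
theorem stageWeight_eq_lineWeight (r : Fin s → ℝ) (z₀ : Fin s → Option (Tree M) → ℝ)
    (z : Fin (M + 1) → Fin s → Fin s → Option (Tree M) → ℝ) (i : Fin s) {τ : Option (Tree M)}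
    (hτ : τ ≠ some (leaf Label.t)) :
    stageWeight r z₀ z i τ =
      lineWeight (z₀ i) (fun m j => z m i j) (stageWeight r z₀ z) τ := by
  rw [stageWeight, stageIter]
  beta_reduce
  rw [if_neg hτ]
  exact lineWeight_congr _ _ fun j σ hσ =>
    stageIter_eq _ _ _ _ _ _ _ (by simpa [size] using hσ) (Nat.lt_succ_self _)

theorem isLine_stageWeight (r : Fin s → ℝ) (z₀ : Fin s → Option (Tree M) → ℝ)
    (z : Fin (M + 1) → Fin s → Fin s → Option (Tree M) → ℝ) (i : Fin s) :
    IsLine (z₀ i) (fun m j => z m i j) (stageWeight r z₀ z) (stageWeight r z₀ z i) where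
  chain_eq l := by
    rw [stageWeight_eq_lineWeight _ _ _ _ (chain_ne_t l)]
    exact (isLine_lineWeight _ _ _).chain_eq l
  graft_eq l δ hδ := by
    rw [stageWeight_eq_lineWeight _ _ _ _ (by simpa using graft_root_ne_t l hδ.2)]
    exact (isLine_lineWeight _ _ _).graft_eq l δ hδ

theorem mem_treesT_cases {τ : Option (Tree M)} (h : τ ∈ treesT M) :
    (∃ l, τ = chain l) ∨ ∃ l, ∃ δ ∈ treesTg M, τ = some (graft l δ) := by
  cases τ with
  | none => exact Or.inl ⟨[], rfl⟩
  | some τ =>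
    obtain h | ⟨l, δ, hδ, rfl⟩ := (h τ rfl).cases_chain
    · exact Or.inl h
    · exact Or.inr ⟨l, δ, hδ, rfl⟩

theorem mem_children_of_treesTg {δ σ : Tree M} (hδ : δ ∈ treesTg M) (hσ : σ ∈ δ.children) :
    σ = leaf Label.t ∨ some σ ∈ treesT M := by
  obtain ⟨hδ, m, hm⟩ := hδ
  by_cases h : σ = leaf Label.t
  · exact Or.inl h
  · right
    rintro _ ⟨⟩
    exact hδ.children_mem hm hσ h

/-- The induction step for uniqueness. Agreement at `•_t` is a separate hypothesis, since `•_t`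
occurs as a branch without belonging to `T`. -/
theorem IsLine.congr {z₀ : Option (Tree M) → ℝ}
    {z : Fin (M + 1) → Fin s → Option (Tree M) → ℝ} {φ ψ : Fin s → Option (Tree M) → ℝ}
    {φ' ψ' : Option (Tree M) → ℝ} (hφ : IsLine z₀ z φ φ') (hψ : IsLine z₀ z ψ ψ')
    (ht : ∀ j, φ j (some (leaf Label.t)) = ψ j (some (leaf Label.t)))
    {τ : Option (Tree M)} (hτ : τ ∈ treesT M)
    (h : ∀ j, ∀ σ ∈ treesT M, size σ < size τ → φ j σ = ψ j σ) : φ' τ = ψ' τ := by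
  obtain ⟨l, rfl⟩ | ⟨l, δ, hδ, rfl⟩ := mem_treesT_cases hτ
  · rw [hφ.chain_eq, hψ.chain_eq]
  · rw [hφ.graft_eq l δ hδ, hψ.graft_eq l δ hδ]
    refine Finset.sum_congr rfl fun m _ => Finset.sum_congr rfl fun j _ => ?_
    rw [compWeight_congr m fun σ hσ => ?_]
    obtain rfl | hσT := mem_children_of_treesTg hδ hσ
    · exact ht j
    · exact h j _ hσT (size_lt_size_graft l hσ)

/-! ### Passage between `IsERKWeights` and `IsLine` -/

section ERK

variable {Ω : Type*} {c : Fin s → ℝ}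
  {ζ₀ : Fin s → Option (Tree M) → ℝ → Ω → ℝ}
  {ζ : Fin (M + 1) → Fin s → Fin s → Option (Tree M) → ℝ → Ω → ℝ}
  {η₀ : Option (Tree M) → ℝ → Ω → ℝ}
  {η : Fin (M + 1) → Fin s → Option (Tree M) → ℝ → Ω → ℝ}
  {Φ : Fin s → Option (Tree M) → ℝ → Ω → ℝ} {Φ' : Option (Tree M) → ℝ → Ω → ℝ}

/-- The recursion is applied to the explicit splitting `(chain l, δ)`, so that splittings disappear
from all later arguments. -/
theorem IsERKWeights.isLine_stage (hΦ : IsERKWeights c ζ₀ ζ η₀ η Φ Φ') (i : Fin s) (h : ℝ)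
    (w : Ω) : IsLine (fun τ => ζ₀ i τ h w) (fun m j τ => ζ m i j τ h w)
      (fun j τ => Φ j τ h w) (fun τ => Φ i τ h w) where
  chain_eq l := hΦ.stage_TA i _ (chain_mem l) h w
  graft_eq l δ hδ := by
    obtain ⟨hδT, m, hm⟩ := hδ
    have hb : bracket (Label.g m) δ.children = δ := by rw [← hm, bracket_root_children]
    have hT : some (graft l δ) ∈ treesT M := by rintro _ ⟨⟩; exact graft_mem l hδT
    rw [hΦ.stage_split i (graft l δ) hT ((some_notMem_treesTA_iff hT).mpr ⟨l, δ, ⟨hδT, m, hm⟩, rfl⟩)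
      (chain l) m δ.children (by rw [hb]; exact chain_mem_SP l δ) (chain_mem l)
      (by rw [hb]; exact ⟨hδT, m, hm⟩) h w]
    conv_rhs => rw [← hb]
    rw [sum_mul_compWeight (fun m j => ζ m i j (chain l) h w)]

theorem IsERKWeights.isLine_step (hΦ : IsERKWeights c ζ₀ ζ η₀ η Φ Φ') (h : ℝ)
    (w : Ω) : IsLine (fun τ => η₀ τ h w) (fun m j τ => η m j τ h w)
      (fun j τ => Φ j τ h w) (fun τ => Φ' τ h w) where
  chain_eq l := hΦ.step_TA _ (chain_mem l) h w
  graft_eq l δ hδ := by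
    obtain ⟨hδT, m, hm⟩ := hδ
    have hb : bracket (Label.g m) δ.children = δ := by rw [← hm, bracket_root_children]
    have hT : some (graft l δ) ∈ treesT M := by rintro _ ⟨⟩; exact graft_mem l hδT
    rw [hΦ.step_split (graft l δ) hT ((some_notMem_treesTA_iff hT).mpr ⟨l, δ, ⟨hδT, m, hm⟩, rfl⟩)
      (chain l) m δ.children (by rw [hb]; exact chain_mem_SP l δ) (chain_mem l)
      (by rw [hb]; exact ⟨hδT, m, hm⟩) h w]
    conv_rhs => rw [← hb]
    rw [sum_mul_compWeight (fun m j => η m j (chain l) h w)]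

/-- Conversely, by `SP_unique` any admissible splitting is the explicit one. -/
theorem IsLine.split {z₀ : Option (Tree M) → ℝ}
    {z : Fin (M + 1) → Fin s → Option (Tree M) → ℝ} {φ : Fin s → Option (Tree M) → ℝ}
    {φ' : Option (Tree M) → ℝ} (hφ : IsLine z₀ z φ φ') {τ : Tree M} (hτ : some τ ∈ treesT M)
    (hA : some τ ∉ treesTA M) {ϑ : Option (Tree M)} {m : Fin (M + 1)} {S : Multiset (Tree M)}
    (hS : (ϑ, bracket (Label.g m) S) ∈ SP τ) (hϑ : ϑ ∈ treesTA M) :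
    φ' (some τ) = ∑ j, z m j ϑ * (S.map fun σ => φ j (some σ)).prod := by
  obtain ⟨l, δ, hδ, rfl⟩ := (some_notMem_treesTA_iff hτ).mp hA
  obtain ⟨rfl, rfl⟩ := SP_unique l hδ.2 ⟨m, rfl⟩ (fun σ hσ => (hϑ σ hσ).2) hS
  rw [hφ.graft_eq l _ hδ, sum_mul_compWeight (fun m j => z m j (chain l))]

theorem inT_leaf_g (m : Fin (M + 1)) : leaf (Label.g m) ∈ treesTg M :=
  ⟨InT.g m 0 (by simp), m, rfl⟩

theorem IsLine.leaf_eq {z₀ : Option (Tree M) → ℝ}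
    {z : Fin (M + 1) → Fin s → Option (Tree M) → ℝ} {φ : Fin s → Option (Tree M) → ℝ}
    {φ' : Option (Tree M) → ℝ} (hφ : IsLine z₀ z φ φ') (m : Fin (M + 1)) :
    φ' (some (leaf (Label.g m))) = ∑ j, z m j none := by
  have := hφ.graft_eq [] _ (inT_leaf_g m)
  rw [graft] at this
  rw [this]
  have := sum_mul_compWeight (fun m j => z m j (chain [])) φ m 0
  rw [Tree.leaf, this]
  simp [chain]

theorem isERKWeights_of_isLine (hζ₀ : ∀ i h w, ζ₀ i none h w = 1) (hη₀ : ∀ h w, η₀ none h w = 1)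
    (ht : ∀ i h w, Φ i (some (Tree.leaf Label.t)) h w = c i * h)
    (hstage : ∀ i h w, IsLine (fun τ => ζ₀ i τ h w) (fun m j τ => ζ m i j τ h w)
      (fun j τ => Φ j τ h w) (fun τ => Φ i τ h w))
    (hstep : ∀ h w, IsLine (fun τ => η₀ τ h w) (fun m j τ => η m j τ h w)
      (fun j τ => Φ j τ h w) (fun τ => Φ' τ h w)) : IsERKWeights c ζ₀ ζ η₀ η Φ Φ' where
  stage_empty i h w := ((hstage i h w).chain_eq []).trans (hζ₀ i h w)
  step_empty h w := ((hstep h w).chain_eq []).trans (hη₀ h w)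
  stage_time := ht
  stage_leaf i m h w := (hstage i h w).leaf_eq m
  step_leaf m h w := (hstep h w).leaf_eq m
  stage_TA i τ hτ h w := by
    obtain ⟨l, rfl⟩ := mem_treesTA_iff.mp hτ
    exact (hstage i h w).chain_eq l
  step_TA τ hτ h w := by
    obtain ⟨l, rfl⟩ := mem_treesTA_iff.mp hτ
    exact (hstep h w).chain_eq l
  stage_split i τ hτ hA ϑ m S hS hϑ _ h w := (hstage i h w).split hτ hA hS hϑ
  step_split τ hτ hA ϑ m S hS hϑ _ h w := (hstep h w).split hτ hA hS hϑ

theorem IsERKWeights.unique {Ψ : Fin s → Option (Tree M) → ℝ → Ω → ℝ}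
    {Ψ' : Option (Tree M) → ℝ → Ω → ℝ} (hΦ : IsERKWeights c ζ₀ ζ η₀ η Φ Φ')
    (hΨ : IsERKWeights c ζ₀ ζ η₀ η Ψ Ψ') {τ : Option (Tree M)} (hτ : τ ∈ treesT M) :
    (∀ i, Ψ i τ = Φ i τ) ∧ Ψ' τ = Φ' τ := by
  have hstage : ∀ n, ∀ i, ∀ τ ∈ treesT M, size τ = n → Ψ i τ = Φ i τ := by
    intro n
    induction n using Nat.strong_induction_on with
    | _ n ih =>
      intro i τ hτ hn
      funext h w
      refine (hΨ.isLine_stage i h w).congr (hΦ.isLine_stage i h w) (fun j => ?_) hτ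
        fun j σ hσ hlt => ?_
      · simp only [hΨ.stage_time, hΦ.stage_time]
      · simp only [ih _ (hn ▸ hlt) j σ hσ rfl]
  refine ⟨fun i => hstage _ i τ hτ rfl, ?_⟩
  funext h w
  refine (hΨ.isLine_step h w).congr (hΦ.isLine_step h w) (fun j => ?_) hτ fun j σ hσ _ => ?_
  · simp only [hΨ.stage_time, hΦ.stage_time]
  · simp only [hstage _ j σ hσ rfl]

theorem measurable_multiset_prod {ι : Type*} [MeasurableSpace Ω] (S : Multiset ι)
    (f : ι → Ω → ℝ) (h : ∀ σ ∈ S, Measurable (f σ)) :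
    Measurable fun w => (S.map fun σ => f σ w).prod := by
  induction S using Multiset.induction with
  | empty => simp
  | cons a S ih =>
    simp only [Multiset.map_cons, Multiset.prod_cons]
    exact (h a (by simp)).mul (ih fun σ hσ => h σ (by simp [hσ]))

theorem measurable_line [MeasurableSpace Ω] {z₀ : Option (Tree M) → Ω → ℝ}
    {z : Fin (M + 1) → Fin s → Option (Tree M) → Ω → ℝ} {φ : Fin s → Option (Tree M) → Ω → ℝ}
    {φ' : Option (Tree M) → Ω → ℝ} {r : Fin s → ℝ}
    (hφ : ∀ w, IsLine (fun τ => z₀ τ w) (fun m j τ => z m j τ w) (fun j τ => φ j τ w)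
      (fun τ => φ' τ w))
    (ht : ∀ j w, φ j (some (Tree.leaf Label.t)) w = r j)
    (hz₀ : ∀ τ ∈ treesTA M, Measurable (z₀ τ)) (hz : ∀ τ ∈ treesTA M, ∀ m j, Measurable (z m j τ))
    {τ : Option (Tree M)} (hτ : τ ∈ treesT M)
    (h : ∀ j, ∀ σ ∈ treesT M, size σ < size τ → Measurable (φ j σ)) : Measurable (φ' τ) := by
  obtain ⟨l, rfl⟩ | ⟨l, δ, hδ, rfl⟩ := mem_treesT_cases hτ
  · rw [show φ' (chain l) = z₀ (chain l) from funext fun w => (hφ w).chain_eq l]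
    exact hz₀ _ (chain_mem l)
  · rw [show φ' (some (graft l δ)) = fun w => _ from funext fun w => (hφ w).graft_eq l δ hδ]
    refine Finset.measurable_fun_sum _ fun m _ => Finset.measurable_fun_sum _ fun j _ => ?_
    refine (hz _ (chain_mem l) m j).mul ?_
    by_cases hm : δ.root = Label.g m
    · simp only [compWeight_of_root m _ hm]
      refine measurable_multiset_prod _ (fun σ => φ j (some σ)) fun σ hσ => ?_
      obtain rfl | hσT := mem_children_of_treesTg hδ hσ
      · rw [show φ j (some (Tree.leaf Label.t)) = fun _ => r j from funext (ht j)]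
        exact measurable_const
      · exact h j _ hσT (size_lt_size_graft l hσ)
    · simp only [compWeight_of_root_ne m _ hm, measurable_const]

theorem IsERKWeights.measurable [MeasurableSpace Ω] (hΦ : IsERKWeights c ζ₀ ζ η₀ η Φ Φ')
    (hm : ∀ τ ∈ treesTA M, ∀ h, (∀ i, Measurable (ζ₀ i τ h)) ∧
      (∀ m i j, Measurable (ζ m i j τ h)) ∧ Measurable (η₀ τ h) ∧ ∀ m i, Measurable (η m i τ h))
    {τ : Option (Tree M)} (hτ : τ ∈ treesT M) (h : ℝ) :
    (∀ i, Measurable (Φ i τ h)) ∧ Measurable (Φ' τ h) := by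
  have hstage : ∀ n, ∀ i, ∀ τ ∈ treesT M, size τ = n → Measurable (Φ i τ h) := by
    intro n
    induction n using Nat.strong_induction_on with
    | _ n ih =>
      intro i τ hτ hn
      exact measurable_line (φ := fun j τ => Φ j τ h) (φ' := fun τ => Φ i τ h)
        (z₀ := fun τ => ζ₀ i τ h) (z := fun m j τ => ζ m i j τ h)
        (fun w => hΦ.isLine_stage i h w) (fun j w => hΦ.stage_time j h w)
        (fun τ hτ => (hm τ hτ h).1 i) (fun τ hτ m j => (hm τ hτ h).2.1 m i j) hτ
        fun j σ hσ hlt => ih _ (hn ▸ hlt) j σ hσ rfl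
  exact ⟨fun i => hstage _ i τ hτ rfl,
    measurable_line (φ := fun j τ => Φ j τ h) (φ' := fun τ => Φ' τ h)
      (z₀ := fun τ => η₀ τ h) (z := fun m j τ => η m j τ h)
      (fun w => hΦ.isLine_step h w) (fun j w => hΦ.stage_time j h w)
      (fun τ hτ => (hm τ hτ h).2.2.1) (fun τ hτ m j => (hm τ hτ h).2.2.2 m j) hτ
      fun j σ hσ _ => hstage _ j σ hσ rfl⟩

end ERK

end Weights

/-! ### Factorisation of elementary differentials and of `α` along chains -/

section ElementaryDifferentials

variable {M d : ℕ} {A : ℝ → EuclideanSpace ℝ (Fin d) →L[ℝ] EuclideanSpace ℝ (Fin d)}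
  {g : Fin (M + 1) → EuclideanSpace ℝ (Fin d) × ℝ → EuclideanSpace ℝ (Fin d)}
  {x : EuclideanSpace ℝ (Fin d)} {t₀ : ℝ}

open BSeriesERK.Tree

-- At a `g` node this is the symmetry of higher derivatives, at an `A` node a reindexing of the sum.
-- It permits evaluating `elemDiff` on any convenient ordering of the branches.
open Classical in
theorem PreTree.elemDiff_congr (hg : ∀ m, ContDiff ℝ ∞ (g m)) :
    ∀ p q : PreTree M, p ≈ q → p.elemDiff A g x t₀ = q.elemDiff A g x t₀
  | .node l n u, .node l' n' u', ⟨hl, e, h⟩ => by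
      subst hl
      obtain rfl : n = n' := by simpa using Fintype.card_congr e
      have hr : ∀ i, (u i).root = (u' (e i)).root := fun i => PreTree.root_congr _ _ (h i)
      have hF : ∀ i, (u i).elemDiff A g x t₀ = (u' (e i)).elemDiff A g x t₀ := fun i =>
        PreTree.elemDiff_congr hg _ _ (h i)
      cases l with
      | g m =>
        simp only [PreTree.elemDiff, hr, hF]
        exact iteratedFDeriv_comp_perm (hg m) (x, t₀) (fun i =>
          if (u' i).root = Label.t then (0, 1) else ((u' i).elemDiff A g x t₀, 0)) e
      | A =>
        have h1 : (∀ i, (u i).root = Label.t) ↔ ∀ i, (u' i).root = Label.t := by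
          simp only [hr]
          exact e.forall_congr_right (q := fun i => (u' i).root = Label.t)
        rw [PreTree.elemDiff, PreTree.elemDiff]
        by_cases h2 : ∀ i, (u' i).root = Label.t
        · rw [if_pos h2, if_pos (h1.mpr h2)]
        · rw [if_neg h2, if_neg (h1.not.mpr h2)]
          simp only [hr, hF]
          exact e.sum_comp fun i => if (u' i).root = Label.t then 0
            else iteratedDeriv (n - 1) A t₀ ((u' i).elemDiff A g x t₀)
      | t => simp only [PreTree.elemDiff]

theorem elemDiff_ofPre (hg : ∀ m, ContDiff ℝ ∞ (g m)) (p : PreTree M) :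
    elemDiff A g x t₀ (some (ofPre p)) = p.elemDiff A g x t₀ :=
  PreTree.elemDiff_congr hg _ _ (ofPre_eq.mp (ofPre_repr _))

theorem root_repr (τ : Tree M) : τ.repr.root = τ.root := by
  conv_rhs => rw [← ofPre_repr τ]
  rfl

variable (A g x t₀) in
open Classical in
/-- The direction that a branch contributes to an elementary differential. -/
noncomputable def direction (τ : Tree M) : EuclideanSpace ℝ (Fin d) × ℝ :=
  if τ.root = Label.t then (0, 1) else (elemDiff A g x t₀ (some τ), 0)

theorem elemDiff_bracket_g (hg : ∀ m, ContDiff ℝ ∞ (g m)) (m : Fin (M + 1)) {n : ℕ}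
    (κ : Fin n → Tree M) :
    elemDiff A g x t₀ (some (bracket (Label.g m) (Finset.univ.val.map κ))) =
      iteratedFDeriv ℝ n (g m) (x, t₀) (direction A g x t₀ ∘ κ) := by
  rw [← ofPre_node_repr, elemDiff_ofPre hg]
  simp only [PreTree.elemDiff, root_repr]
  congr 1
  funext i
  rw [Function.comp, direction]
  have hr := root_repr (κ i)
  by_cases h : (κ i).root = Label.t
  · rw [if_pos h, if_pos (hr.trans h)]
  · rw [if_neg h, if_neg (hr ▸ h)]
    rfl

theorem elemDiff_bracket_A_replicate (hg : ∀ m, ContDiff ℝ ∞ (g m)) (n : ℕ) :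
    elemDiff A g x t₀ (some (bracket Label.A (Multiset.replicate n (leaf Label.t)))) =
      iteratedDeriv n A t₀ x := by
  have : Multiset.replicate n (leaf Label.t : Tree M) =
      Finset.univ.val.map fun _ : Fin n => leaf Label.t := by simp [Multiset.map_const']
  rw [this, ← ofPre_node_repr, elemDiff_ofPre hg]
  simp [PreTree.elemDiff, root_repr, leaf_root]

theorem elemDiff_bracket_A_cons (hg : ∀ m, ContDiff ℝ ∞ (g m)) (n : ℕ) {σ : Tree M}
    (hσ : σ.root ≠ Label.t) :
    elemDiff A g x t₀ (some (bracket Label.A (σ ::ₘ Multiset.replicate n (leaf Label.t)))) =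
      iteratedDeriv n A t₀ (elemDiff A g x t₀ (some σ)) := by
  have : σ ::ₘ Multiset.replicate n (leaf Label.t : Tree M) =
      Finset.univ.val.map (Fin.cons σ fun _ : Fin n => leaf Label.t) := by
    rw [Fin.univ_succ, Finset.cons_val, Multiset.map_cons, Finset.map_val, Multiset.map_map]
    simp [Multiset.map_const', -Fin.univ_val_map]
  rw [this, ← ofPre_node_repr, elemDiff_ofPre hg]
  have h : ¬ ∀ i : Fin (n + 1), (Fin.cons (α := fun _ => Tree M) σ (fun _ : Fin n => leaf Label.t) i).repr.root
      = Label.t := fun h => hσ (by simpa [root_repr] using h 0)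
  rw [PreTree.elemDiff, if_neg h, Fin.sum_univ_succ]
  simp [root_repr, leaf_root, hσ]
  rfl

variable (A t₀) in
/-- The linear map `x ↦ F(chain l)(x, t₀)`. -/
noncomputable def chainOp : List ℕ → EuclideanSpace ℝ (Fin d) →L[ℝ] EuclideanSpace ℝ (Fin d)
  | [] => ContinuousLinearMap.id ℝ _
  | n :: l => (iteratedDeriv n A t₀).comp (chainOp l)

/-- The coefficient `α(chain l)`. -/
noncomputable def chainAlpha (l : List ℕ) : ℝ := (l.map fun n => (n.factorial : ℝ)⁻¹).prod

theorem chain_cases (l : List ℕ) :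
    (l = [] ∧ (chain l : Option (Tree M)) = none) ∨
      ∃ σ : Tree M, chain l = some σ ∧ σ.root = Label.A := by
  cases l with
  | nil => exact Or.inl ⟨rfl, rfl⟩
  | cons n l => exact Or.inr ⟨_, rfl, root_bracket _ _⟩

theorem graft_root (l : List ℕ) {δ : Tree M} (hδ : GRoot δ) : (graft l δ).root ≠ Label.t := by
  cases l with
  | nil => obtain ⟨m, hm⟩ := hδ; simp [graft, hm]
  | cons n l => simp [graft, root_bracket]

theorem elemDiff_chain (hg : ∀ m, ContDiff ℝ ∞ (g m)) (l : List ℕ) :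
    elemDiff A g x t₀ (chain l) = chainOp A t₀ l x := by
  induction l with
  | nil => rfl
  | cons n l ih =>
    obtain ⟨rfl, h⟩ | ⟨σ, h, hσ⟩ := chain_cases (M := M) l
    · simpa [chain, chainOp] using elemDiff_bracket_A_replicate hg n
    · rw [h] at ih
      have := elemDiff_bracket_A_cons (A := A) (x := x) (t₀ := t₀) hg n (σ := σ) (by simp [hσ])
      simp only [chain, h, Option.elim_some, Multiset.singleton_add, this, ih]
      rfl

theorem elemDiff_graft (hg : ∀ m, ContDiff ℝ ∞ (g m)) (l : List ℕ) {δ : Tree M}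
    (hδ : GRoot δ) :
    elemDiff A g x t₀ (some (graft l δ)) = chainOp A t₀ l (elemDiff A g x t₀ (some δ)) := by
  induction l with
  | nil => rfl
  | cons n l ih =>
    rw [graft, elemDiff_bracket_A_cons hg n (graft_root l hδ), ih]
    rfl

/-- As `σ` differs from the repeated branch, its multiplicity is one and the symmetry factor is
exactly `n!`. -/
theorem alpha_bracket_cons_replicate (l : Label M) {σ τ : Tree M} (h : σ ≠ τ) (n : ℕ) :
    (bracket l (σ ::ₘ Multiset.replicate n τ)).alpha =
      (n.factorial : ℝ)⁻¹ * (σ.alpha * τ.alpha ^ n) := by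
  classical
  rw [alpha_bracket]
  have : ∏ ρ ∈ (σ ::ₘ Multiset.replicate n τ).toFinset,
      ((σ ::ₘ Multiset.replicate n τ).count ρ).factorial = n.factorial := by
    rw [Finset.prod_subset (s₂ := {σ, τ}), Finset.prod_pair h]
    · simp [Multiset.count_replicate, h.symm]
    · intro ρ hρ
      simp only [Multiset.mem_toFinset, Multiset.mem_cons] at hρ
      obtain rfl | hρ := hρ
      · simp
      · simp [Multiset.eq_of_mem_replicate hρ]
    · intro ρ _ hρ
      rw [Multiset.count_eq_zero_of_notMem (by simpa only [Multiset.mem_toFinset] using hρ),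
        Nat.factorial_zero]
  rw [this]
  simp
  ring

theorem alpha_bracket_replicate (l : Label M) (τ : Tree M) (n : ℕ) :
    (bracket l (Multiset.replicate n τ)).alpha = (n.factorial : ℝ)⁻¹ * τ.alpha ^ n := by
  classical
  rw [alpha_bracket]
  have : ∏ ρ ∈ (Multiset.replicate n τ).toFinset,
      ((Multiset.replicate n τ).count ρ).factorial = n.factorial := by
    rw [Finset.prod_subset (s₂ := {τ}), Finset.prod_singleton]
    · simp
    · intro ρ hρ
      simp [Multiset.eq_of_mem_replicate (Multiset.mem_toFinset.mp hρ)]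
    · intro ρ _ hρ
      rw [Multiset.count_eq_zero_of_notMem (by simpa only [Multiset.mem_toFinset] using hρ),
        Nat.factorial_zero]
  rw [this]
  simp
  ring

theorem alpha_chain (l : List ℕ) : alpha (chain l : Option (Tree M)) = chainAlpha l := by
  induction l with
  | nil => simp [alpha, chain, chainAlpha]
  | cons n l ih =>
    obtain ⟨rfl, h⟩ | ⟨σ, h, hσ⟩ := chain_cases (M := M) l
    · simp [chain, chainAlpha, BSeriesERK.alpha, alpha_bracket_replicate, alpha_leaf]
    · rw [h] at ih
      have hne : σ ≠ leaf Label.t := by rintro rfl; simp [leaf_root] at hσ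
      have := alpha_bracket_cons_replicate Label.A hne n
      simp only [chain, h, Option.elim_some, Multiset.singleton_add, BSeriesERK.alpha, this,
        alpha_leaf, one_pow, mul_one]
      rw [show σ.alpha = _ from ih]
      simp [chainAlpha]

theorem alpha_graft (l : List ℕ) {δ : Tree M} (hδ : GRoot δ) :
    (graft l δ).alpha = chainAlpha l * δ.alpha := by
  induction l with
  | nil => simp [graft, chainAlpha]
  | cons n l ih =>
    rw [graft, alpha_bracket_cons_replicate _ (graft_root_ne_t l hδ), ih]
    simp [chainAlpha, alpha_leaf, mul_assoc]

theorem bTerm_chain (hg : ∀ m, ContDiff ℝ ∞ (g m)) (φ : Option (Tree M) → ℝ) (l : List ℕ) :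
    bTerm A g x t₀ φ (chain l) = ((chainAlpha l * φ (chain l)) • chainOp A t₀ l) x := by
  rw [bTerm, elemDiff_chain hg, alpha_chain]
  rfl

/-- All three ingredients `α`, weight and `F` factor over `(l, δ)`. This is the termwise form of
applying a coefficient matrix to the series of `g_m`. -/
theorem bTerm_graft {s : ℕ} (hg : ∀ m, ContDiff ℝ ∞ (g m)) {z₀ : Option (Tree M) → ℝ}
    {z : Fin (M + 1) → Fin s → Option (Tree M) → ℝ} {φ : Fin s → Option (Tree M) → ℝ}
    {φ' : Option (Tree M) → ℝ} (hφ : IsLine z₀ z φ φ') (l : List ℕ) {δ : Tree M}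
    (hδ : δ ∈ treesTg M) :
    bTerm A g x t₀ φ' (some (graft l δ)) = ∑ m, ∑ j,
      ((chainAlpha l * z m j (chain l)) • chainOp A t₀ l)
        (bTerm A g x t₀ (compWeight m (φ j)) (some δ)) := by
  simp only [bTerm, elemDiff_graft hg l hδ.2, alpha, alpha_graft l hδ.2, hφ.graft_eq l δ hδ,
    Finset.mul_sum, Finset.sum_smul, map_smul, smul_apply, smul_smul]
  refine Finset.sum_congr rfl fun m _ => Finset.sum_congr rfl fun j _ => ?_
  congr 1
  ring

theorem gradedPart_eq_sum (𝒯 : Set (Option (Tree M))) (φ : Option (Tree M) → ℝ) (n : ℕ) :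
    gradedPart 𝒯 A g x t₀ φ n = ∑ τ ∈ (finite_size_eq 𝒯 n).toFinset, bTerm A g x t₀ φ τ :=
  finsum_mem_eq_finite_toFinset_sum _ (finite_size_eq 𝒯 n)

theorem size_eq_zero_iff {τ : Option (Tree M)} : size τ = 0 ↔ τ = none := by
  cases τ with
  | none => simp [size]
  | some τ =>
    have := one_le_size τ
    simp only [size, reduceCtorEq, iff_false]
    omega

theorem gradedPart_zero {𝒯 : Set (Option (Tree M))} (h : none ∈ 𝒯) (φ : Option (Tree M) → ℝ) :
    gradedPart 𝒯 A g x t₀ φ 0 = φ none • x := by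
  have : (finite_size_eq 𝒯 0).toFinset = {none} := by
    ext τ
    simp only [Set.Finite.mem_toFinset, Set.mem_ofPred_eq, size_eq_zero_iff, Finset.mem_singleton]
    exact ⟨fun h => h.2, fun h' => ⟨h' ▸ h, h'⟩⟩
  rw [gradedPart_eq_sum, this, Finset.sum_singleton]
  simp [bTerm, BSeriesERK.alpha, elemDiff]

/-- The trees that may occur as branches of a tree in `T` with root `g m`, up to some size. -/
theorem finite_branches (b : ℕ) :
    {τ : Tree M | τ = leaf Label.t ∨ InT τ ∧ τ.size ≤ b}.Finite :=
  ((finite_size_le b).insert (leaf Label.t)).subset fun _ h => h.imp id fun h => h.2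

theorem sum_range_gradedPart {𝒯 : Set (Option (Tree M))} (φ : Option (Tree M) → ℝ) (b : ℕ)
    (a : ℕ → ℝ) (K : Finset (Option (Tree M))) (hK : ∀ τ, τ ∈ K ↔ τ ∈ 𝒯 ∧ size τ < b) :
    ∑ k ∈ Finset.range b, a k • gradedPart 𝒯 A g x t₀ φ k =
      ∑ τ ∈ K, a (size τ) • bTerm A g x t₀ φ τ := by
  rw [← Finset.sum_fiberwise_of_maps_to (t := Finset.range b) (g := size)
    (fun τ hτ => Finset.mem_range.mpr ((hK τ).mp hτ).2)]
  refine Finset.sum_congr rfl fun k hk => ?_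
  rw [gradedPart_eq_sum, Finset.smul_sum]
  refine Finset.sum_congr ?_ fun τ hτ => ?_
  · ext τ
    simp only [Set.Finite.mem_toFinset, Set.mem_ofPred_eq, Finset.mem_filter, hK]
    have := Finset.mem_range.mp hk
    constructor
    · rintro ⟨h1, rfl⟩; exact ⟨⟨h1, this⟩, rfl⟩
    · rintro ⟨h1, h2⟩; exact ⟨h1.1, h2⟩
  · rw [(Finset.mem_filter.mp hτ).2]

end ElementaryDifferentials
-- The formal expansion of `g_m` along a B-series
section Composition

variable {M d : ℕ} {A : ℝ → EuclideanSpace ℝ (Fin d) →L[ℝ] EuclideanSpace ℝ (Fin d)}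
  {g : Fin (M + 1) → EuclideanSpace ℝ (Fin d) × ℝ → EuclideanSpace ℝ (Fin d)}
  {x : EuclideanSpace ℝ (Fin d)} {t₀ : ℝ}

open BSeriesERK.Tree

open Classical in
theorem bTerm_compWeight_bracket (φ : Option (Tree M) → ℝ) (m : Fin (M + 1))
    (S : Multiset (Tree M)) :
    bTerm A g x t₀ (compWeight m φ) (some (bracket (Label.g m) S)) =
      ((∏ σ ∈ S.toFinset, (S.count σ).factorial : ℕ) : ℝ)⁻¹ •
        (S.map fun σ => σ.alpha * φ (some σ)).prod •
          elemDiff A g x t₀ (some (bracket (Label.g m) S)) := by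
  rw [bTerm, compWeight_of_root _ _ (root_bracket _ _), children_bracket, alpha,
    alpha_bracket, Multiset.prod_map_mul, smul_smul]
  congr 1
  rw [div_eq_inv_mul, mul_assoc]

theorem finite_multisets (b : ℕ) :
    {S : Multiset (Tree M) | (∀ σ ∈ S, σ = leaf Label.t ∨ InT σ) ∧ (S.map Tree.size).sum = b}.Finite := by
  -- Joining the trees to a root embeds these multisets into a finite set of trees; the label is
  -- immaterial.
  refine Set.Finite.of_injOn (f := fun S => bracket Label.A S) (t := {τ | τ.size ≤ b + 1}) ?_ ?_
    (finite_size_le _)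
  · rintro S ⟨_, hS⟩
    rw [Set.mem_ofPred_eq, size_bracket, hS]
    omega
  · intro S _ S' _ h
    exact (bracket_inj.mp h).2

theorem gradedPart_compWeight (φ : Option (Tree M) → ℝ) (m : Fin (M + 1)) (b : ℕ) :
    gradedPart (treesT M) A g x t₀ (compWeight m φ) (b + 1) =
      ∑ S ∈ (finite_multisets b).toFinset,
        bTerm A g x t₀ (compWeight m φ) (some (bracket (Label.g m) S)) := by
  rw [gradedPart_eq_sum]
  symm
  refine Finset.sum_of_injOn (fun S => some (bracket (Label.g m) S)) ?_ ?_ ?_ fun _ _ => rfl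
  · intro S _ S' _ h
    exact (bracket_inj.mp (Option.some.inj h)).2
  · intro S hS
    obtain ⟨hS, hb⟩ := (finite_multisets b).mem_toFinset.mp hS
    refine (finite_size_eq _ _).mem_toFinset.mpr ⟨?_, ?_⟩
    · rintro _ ⟨⟩
      exact InT.g m S fun σ hσ h => (hS σ hσ).resolve_left h
    · rw [BSeriesERK.size, size_bracket, hb, add_comm]
  · intro τ hτ hnot
    obtain ⟨hτT, hτ⟩ := (finite_size_eq _ _).mem_toFinset.mp hτ
    cases τ with
    | none => simp [BSeriesERK.size] at hτ
    | some τ =>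
      by_cases hm : τ.root = Label.g m
      · refine absurd ⟨τ.children, (finite_multisets b).mem_toFinset.mpr ⟨fun σ hσ => ?_, ?_⟩, ?_⟩
          hnot
        · by_cases h : σ = leaf Label.t
          · exact Or.inl h
          · exact Or.inr ((hτT τ rfl).children_mem hm hσ h)
        · rw [BSeriesERK.size, ← bracket_root_children τ, size_bracket] at hτ
          omega
        · beta_reduce
          rw [← hm, bracket_root_children]
      · simp [bTerm, compWeight_of_root_ne m φ hm]

/-- The Taylor expansion of `g_m(B(φ, x, t₀), t₀ + r)` is a formal B-series. -/
theorem taylorPart_gradedPart (hg : ∀ m, ContDiff ℝ ∞ (g m)) {φ : Option (Tree M) → ℝ} {r : ℝ}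
    (hφ : φ none = 1) (hr : φ (some (leaf Label.t)) = r) (m : Fin (M + 1)) (b : ℕ) :
    taylorPart (g m) (gradedPart (treesT M) A g x t₀ φ) t₀ r b =
      gradedPart (treesT M) A g x t₀ (compWeight m φ) (b + 1) := by
  classical
  set J : Finset (Tree M) := (finite_branches b).toFinset.erase (leaf Label.t) with hJ
  have hmemJ : ∀ τ, τ ∈ J ↔ InT τ ∧ τ.size ≤ b := by
    intro τ
    simp only [hJ, Finset.mem_erase, Set.Finite.mem_toFinset, Set.mem_ofPred_eq]
    constructor
    · rintro ⟨h1, h2⟩; exact h2.resolve_left h1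
    · rintro h; exact ⟨h.1.ne_leaf_t, Or.inr h⟩
  have htJ : leaf Label.t ∉ J := fun h => ((hmemJ _).mp h).1.ne_leaf_t rfl
  set I : Finset (Tree M) := insert (leaf Label.t) J with hI
  set v : Tree M → EuclideanSpace ℝ (Fin d) × ℝ :=
    fun σ => (σ.alpha * φ (some σ)) • direction A g x t₀ σ with hv
  -- Space and time together form one polynomial curve through `(x, t₀)`: each branch contributes
  -- its direction with exponent its number of nodes, and `•_t` accounts for `ε * r`.
  have hcurve : ∀ ε : ℝ, (∑ k ∈ Finset.range (b + 1), ε ^ k •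
      gradedPart (treesT M) A g x t₀ φ k, t₀ + ε * r) =
      (x, t₀) + ∑ σ ∈ I, ε ^ σ.size • v σ := by
    intro ε
    have h1 : v (leaf Label.t) = (0, r) := by
      simp [hv, direction, leaf_root, alpha_leaf, hr]
    have h2 : ∀ σ ∈ J, ε ^ σ.size • v σ = (ε ^ σ.size • bTerm A g x t₀ φ (some σ), 0) := by
      intro σ hσ
      simp [hv, direction, ((hmemJ σ).mp hσ).1.root_ne_t, bTerm, BSeriesERK.alpha]
    rw [hI, Finset.sum_insert htJ, h1, Finset.sum_congr rfl h2, size_leaf,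
      sum_range_gradedPart φ (b + 1) (fun k => ε ^ k)
        (insert none (J.map Function.Embedding.some))]
    · rw [Finset.sum_insert (by simp), Finset.sum_map]
      refine Prod.ext ?_ ?_
      · simp [Prod.fst_sum, bTerm, BSeriesERK.alpha, BSeriesERK.size, hφ, elemDiff]
      · simp [Prod.snd_sum]
    · rintro (_ | τ)
      · simp [treesT, BSeriesERK.size]
      · simp [hmemJ, treesT, BSeriesERK.size]
  rw [taylorPart]
  simp only [hcurve]
  rw [taylor_coeff_comp I Tree.size (fun σ _ => one_le_size σ) v (hg m) (x, t₀) b,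
    gradedPart_compWeight, ← Finset.sum_fiberwise_of_maps_to (t := Finset.range (b + 1))
      (g := Multiset.card)]
  · refine Finset.sum_congr rfl fun n hn => ?_
    set G : Multiset (Tree M) → EuclideanSpace ℝ (Fin d) := fun S =>
      (S.map fun σ => σ.alpha * φ (some σ)).prod •
        elemDiff A g x t₀ (some (bracket (Label.g m) S)) with hG
    -- By multilinearity and symmetry, the summand depends only on the multiset of letters of `κ`.
    have hκ : ∀ κ : Fin n → Tree M, iteratedFDeriv ℝ n (g m) (x, t₀) (v ∘ κ) =
        G (Finset.univ.val.map κ) := by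
      intro κ
      simp only [hG, hv, Function.comp_def]
      rw [ContinuousMultilinearMap.map_smul_univ, elemDiff_bracket_g hg, Multiset.map_map]
      rfl
    have hmaps : ∀ κ ∈ ({κ ∈ Fintype.piFinset (fun _ : Fin n => I) | ∑ j, (κ j).size = b} :
        Finset (Fin n → Tree M)), Finset.univ.val.map κ ∈
          ({S ∈ (finite_multisets b).toFinset | S.card = n} : Finset (Multiset (Tree M))) := by
      intro κ hκ
      obtain ⟨hκI, hκb⟩ := Finset.mem_filter.mp hκ
      refine Finset.mem_filter.mpr ⟨(finite_multisets b).mem_toFinset.mpr ⟨?_, ?_⟩, by simp⟩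
      · intro σ hσ
        obtain ⟨i, _, rfl⟩ := Multiset.mem_map.mp hσ
        have := Fintype.mem_piFinset.mp hκI i
        rw [hI, Finset.mem_insert, hmemJ] at this
        exact this.imp id fun h => h.1
      · rw [Multiset.map_map]; exact hκb
    simp only [hκ]
    rw [← Finset.sum_fiberwise_of_maps_to hmaps, Finset.smul_sum]
    refine Finset.sum_congr rfl fun S hS => ?_
    obtain ⟨hS, hcard⟩ := Finset.mem_filter.mp hS
    obtain ⟨hST, hSb⟩ := (finite_multisets b).mem_toFinset.mp hS
    have hSI : ∀ σ ∈ S, σ ∈ I := by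
      intro σ hσ
      rw [hI, Finset.mem_insert, hmemJ]
      refine (hST σ hσ).imp id fun h => ⟨h, ?_⟩
      rw [← hSb]
      exact Multiset.single_le_sum (fun _ _ => Nat.zero_le _) _ (Multiset.mem_map_of_mem _ hσ)
    have hfil : ({κ ∈ ({κ ∈ Fintype.piFinset (fun _ : Fin n => I) | ∑ j, (κ j).size = b} :
        Finset (Fin n → Tree M)) | Finset.univ.val.map κ = S} : Finset (Fin n → Tree M)) =
        {κ ∈ Fintype.piFinset (fun _ : Fin n => I) | Finset.univ.val.map κ = S} := by
      ext κ
      simp only [Finset.mem_filter]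
      constructor
      · rintro ⟨⟨h1, _⟩, h2⟩; exact ⟨h1, h2⟩
      · rintro ⟨h1, h2⟩
        refine ⟨⟨h1, ?_⟩, h2⟩
        rw [← hSb, ← h2, Multiset.map_map]; rfl
    rw [hfil, Finset.sum_congr rfl fun κ hκ => by rw [(Finset.mem_filter.mp hκ).2],
      Finset.sum_const, ← Nat.cast_smul_eq_nsmul ℝ, smul_smul, bTerm_compWeight_bracket]
    congr 1
    -- The number of words over `S` times `1/n!` is the reciprocal of the product of the factorials
    -- of the multiplicities.
    have hc := card_map_univ_eq_mul I S hSI hcard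
    have h1 : (n.factorial : ℝ) ≠ 0 := by positivity
    have hc' : ((Finset.card {κ ∈ Fintype.piFinset (fun _ : Fin n => I) |
        Finset.univ.val.map κ = S} : ℕ) : ℝ) *
        ((∏ σ ∈ S.toFinset, (S.count σ).factorial : ℕ) : ℝ) = n.factorial := by
      exact_mod_cast hc
    have h2 : ((∏ σ ∈ S.toFinset, (S.count σ).factorial : ℕ) : ℝ) ≠ 0 := by
      intro h; rw [h, mul_zero] at hc'; exact h1 hc'.symm
    rw [← hc'] at h1 ⊢
    field_simp
    exact div_self (left_ne_zero_of_mul h1)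
  · intro S hS
    obtain ⟨_, hSb⟩ := (finite_multisets b).mem_toFinset.mp hS
    have := Multiset.card_nsmul_le_sum (s := S.map Tree.size) (a := 1) (by
      intro x hx
      obtain ⟨σ, _, rfl⟩ := Multiset.mem_map.mp hx
      exact one_le_size σ)
    simp only [Multiset.card_map, smul_eq_mul, mul_one] at this
    exact Finset.mem_range.mpr (by omega)

end Composition
-- Analytic functions along convergent series
section PowerSeries

variable {E F : Type*} [NormedAddCommGroup E] [NormedSpace ℝ E] [CompleteSpace E]
  [NormedAddCommGroup F] [NormedSpace ℝ F] [CompleteSpace F]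

/-- The power series in one real variable with absolutely summable coefficients `a`. -/
noncomputable def powerSeries (a : ℕ → E) : FormalMultilinearSeries ℝ ℝ E := fun n =>
  ContinuousMultilinearMap.mkPiRing ℝ (Fin n) (a n)

theorem powerSeries_hasFPowerSeriesOnBall {a : ℕ → E} (ha : Summable fun n => ‖a n‖) :
    HasFPowerSeriesOnBall (fun ε : ℝ => ∑' n, ε ^ n • a n) (powerSeries a) 0 1 := by
  have h1 : (1 : ENNReal) ≤ (powerSeries a).radius := by
    have := (powerSeries a).le_radius_of_summable_norm (r := 1) (by
      simpa [powerSeries] using ha)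
    simpa using this
  have h2 := ((powerSeries a).hasFPowerSeriesOnBall (zero_lt_one.trans_le h1)).mono
    zero_lt_one h1
  have h3 : (powerSeries a).sum = fun ε : ℝ => ∑' n, ε ^ n • a n := by
    funext ε
    simp [FormalMultilinearSeries.sum, powerSeries]
  rwa [h3] at h2

theorem iteratedDeriv_tsum_pow_smul {a : ℕ → E} (ha : Summable fun n => ‖a n‖) (n : ℕ) :
    iteratedDeriv n (fun ε : ℝ => ∑' n, ε ^ n • a n) 0 = (n.factorial : ℝ) • a n := by
  have := (powerSeries_hasFPowerSeriesOnBall ha).factorial_smul 1 n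
  rw [iteratedDeriv_eq_iteratedFDeriv, ← this]
  simp [powerSeries, Nat.cast_smul_eq_nsmul]

/-- Weierstrass test with majorant `‖a n‖`. Including the endpoint `1` is the point: it lies outside
the open ball of analyticity. -/
theorem continuousOn_tsum_pow_smul {a : ℕ → E} (ha : Summable fun n => ‖a n‖) :
    ContinuousOn (fun ε : ℝ => ∑' n, ε ^ n • a n) (Set.Icc 0 1) := by
  refine continuousOn_tsum (fun n => by fun_prop) ha fun n ε hε => ?_
  rw [norm_smul, norm_pow]
  refine mul_le_of_le_one_left (norm_nonneg _) (pow_le_one₀ (norm_nonneg _) ?_)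
  rw [Real.norm_eq_abs, abs_of_nonneg hε.1]
  exact hε.2

theorem analyticAt_eventuallyEq_of_iteratedDeriv {f f' : ℝ → E} {t : ℝ} (hf : AnalyticAt ℝ f t)
    (hf' : AnalyticAt ℝ f' t) (h : ∀ n, iteratedDeriv n f t = iteratedDeriv n f' t) :
    ∀ᶠ ε in nhds t, f ε = f' ε := by
  obtain ⟨p, hp⟩ := hf
  obtain ⟨p', hp'⟩ := hf'
  have hpp : p = p' := by
    funext n
    refine ContinuousMultilinearMap.ext_ring ?_
    obtain ⟨ρ, hρ⟩ := hp
    obtain ⟨ρ', hρ'⟩ := hp'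
    have h1 := hρ.factorial_smul 1 n
    have h2 := hρ'.factorial_smul 1 n
    have h3 := h n
    rw [iteratedDeriv_eq_iteratedFDeriv, iteratedDeriv_eq_iteratedFDeriv, ← h1, ← h2,
      ← Nat.cast_smul_eq_nsmul ℝ, ← Nat.cast_smul_eq_nsmul ℝ] at h3
    exact smul_right_injective _ (by positivity) h3
  subst hpp
  filter_upwards [hp.eventually_hasSum_sub, hp'.eventually_hasSum_sub] with ε h1 h2
  exact h1.unique h2

theorem iteratedDeriv_clm_comp {G G' : Type*} [NormedAddCommGroup G] [NormedSpace ℝ G]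
    [NormedAddCommGroup G'] [NormedSpace ℝ G'] (L : G →L[ℝ] G') {γ : ℝ → G} {t : ℝ} (hγ : ContDiffAt ℝ ∞ γ t) (k : ℕ) :
    iteratedDeriv k (fun ε => L (γ ε)) t = L (iteratedDeriv k γ t) := by
  rw [iteratedDeriv_eq_iteratedFDeriv, iteratedDeriv_eq_iteratedFDeriv]
  have := L.iteratedFDeriv_comp_left hγ (i := k) (by exact_mod_cast le_top)
  change iteratedFDeriv ℝ k (L ∘ γ) t _ = _
  rw [this]
  rfl

theorem iteratedDeriv_prodMk_congr {E : Type*} [NormedAddCommGroup E] [NormedSpace ℝ E]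
    {γ γ' : ℝ → E} {τ : ℝ → ℝ} {t : ℝ} (hγ : ContDiffAt ℝ ∞ γ t)
    (hγ' : ContDiffAt ℝ ∞ γ' t) (hτ : ContDiffAt ℝ ∞ τ t) {k : ℕ}
    (h : iteratedDeriv k γ t = iteratedDeriv k γ' t) :
    iteratedDeriv k (fun ε => (γ ε, τ ε)) t = iteratedDeriv k (fun ε => (γ' ε, τ ε)) t := by
  refine Prod.ext ?_ ?_
  · have h1 := iteratedDeriv_clm_comp (ContinuousLinearMap.fst ℝ E ℝ) (hγ.prodMk hτ) k
    have h2 := iteratedDeriv_clm_comp (ContinuousLinearMap.fst ℝ E ℝ) (hγ'.prodMk hτ) k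
    exact h1.symm.trans (h.trans h2)
  · have h1 := iteratedDeriv_clm_comp (ContinuousLinearMap.snd ℝ E ℝ) (hγ.prodMk hτ) k
    have h2 := iteratedDeriv_clm_comp (ContinuousLinearMap.snd ℝ E ℝ) (hγ'.prodMk hτ) k
    exact h1.symm.trans h2

/-- If a formal series and the formal Taylor expansion of an analytic function along it
both converge, then the sums correspond. -/
theorem apply_tsum_eq_tsum_taylor {f : E × ℝ → F} (hf : AnalyticOnNhd ℝ f Set.univ) {a : ℕ → E}
    {b : ℕ → F} (ha : Summable fun n => ‖a n‖) (hb : Summable fun n => ‖b n‖) (t₀ r : ℝ)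
    (h : ∀ n, b n = ((n.factorial : ℝ)⁻¹) • iteratedDeriv n
      (fun ε : ℝ => f (∑ k ∈ Finset.range (n + 1), ε ^ k • a k, t₀ + ε * r)) 0) :
    f (∑' n, a n, t₀ + r) = ∑' n, b n := by
  set Sa : ℝ → E := fun ε => ∑' n, ε ^ n • a n with hSa
  set Sb : ℝ → F := fun ε => ∑' n, ε ^ n • b n with hSb
  have hSa' := powerSeries_hasFPowerSeriesOnBall ha
  have hSb' := powerSeries_hasFPowerSeriesOnBall hb
  have hfs : ContDiff ℝ ∞ f := contDiff_iff_contDiffAt.mpr fun y =>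
    (hf y (Set.mem_univ y)).contDiffAt
  have hγan : AnalyticOnNhd ℝ (fun ε => f (Sa ε, t₀ + ε * r)) (Metric.eball 0 1) := by
    intro ε hε
    refine (hf _ (Set.mem_univ _)).comp (f := fun ε => (Sa ε, t₀ + ε * r))
      ((hSa'.analyticOnNhd ε hε).prod ?_)
    fun_prop
  have h0 : (0 : ℝ) ∈ Metric.eball (0 : ℝ) 1 := Metric.mem_eball_self zero_lt_one
  have hSa0 : ContDiffAt ℝ ∞ Sa 0 := (hSa'.analyticOnNhd 0 h0).contDiffAt
  -- Truncating the inner series after degree `n` does not change its derivatives at `0` up to order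
  -- `n`, so the hypothesis on `b n` applies.
  have hderiv : ∀ n, iteratedDeriv n (fun ε => f (Sa ε, t₀ + ε * r)) 0 = iteratedDeriv n Sb 0 := by
    intro n
    rw [hSb, iteratedDeriv_tsum_pow_smul hb, h n, smul_smul, mul_inv_cancel₀ (by positivity),
      one_smul]
    have hp : ContDiff ℝ ∞ fun ε : ℝ => ∑ k ∈ Finset.range (n + 1), ε ^ k • a k := by fun_prop
    have ht : ContDiff ℝ ∞ fun ε : ℝ => t₀ + ε * r := by fun_prop
    refine iteratedDeriv_comp_congr (γ := fun ε => (Sa ε, t₀ + ε * r))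
      (γ' := fun ε => (∑ k ∈ Finset.range (n + 1), ε ^ k • a k, t₀ + ε * r)) hfs hfs
      (hSa0.prodMk ht.contDiffAt) (hp.prodMk ht).contDiffAt (fun _ _ => rfl) fun k hk => ?_
    refine iteratedDeriv_prodMk_congr hSa0 hp.contDiffAt ht.contDiffAt ?_
    have h1 := iteratedDeriv_sum_pow_smul (Finset.range (n + 1)) (fun i => i) a k
    rw [hSa, iteratedDeriv_tsum_pow_smul ha]
    have h2 : ∑ i ∈ Finset.range (n + 1) with i = k, a i = a k := by
      rw [Finset.sum_filter, Finset.sum_ite_eq' (Finset.range (n + 1)) k a,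
        if_pos (Finset.mem_range.mpr (by omega))]
    rw [h2] at h1
    rw [← h1, smul_smul, mul_inv_cancel₀ (by positivity), one_smul]
  have hev := analyticAt_eventuallyEq_of_iteratedDeriv (hγan 0 h0) (hSb'.analyticOnNhd 0 h0) hderiv
  have hpre : IsPreconnected (Metric.eball (0 : ℝ) 1) := by
    have := (convex_ball (0 : ℝ) 1).isPreconnected
    rwa [← Metric.eball_ofReal, ENNReal.ofReal_one] at this
  have heq := hγan.eqOn_of_preconnected_of_eventuallyEq hSb'.analyticOnNhd hpre h0 hev
  have hIco : Set.EqOn (fun ε => f (Sa ε, t₀ + ε * r)) Sb (Set.Ico 0 1) := by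
    intro ε hε
    refine heq ?_
    rw [← ENNReal.ofReal_one, Metric.eball_ofReal, mem_ball_zero_iff, Real.norm_eq_abs,
      abs_of_nonneg hε.1]
    exact hε.2
  -- Both sides are continuous on `[0, 1]`, so equality on `[0, 1)` extends to `ε = 1`.
  have hIcc := hIco.of_subset_closure (t := Set.Icc 0 1)
    (hfs.continuous.comp_continuousOn
      ((continuousOn_tsum_pow_smul ha).prodMk (by fun_prop)))
    (continuousOn_tsum_pow_smul hb) Set.Ico_subset_Icc_self
    (by rw [closure_Ico (by norm_num)])
  have := hIcc (Set.right_mem_Icc.mpr zero_le_one)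
  simpa [hSa, hSb] using this

end PowerSeries

/-! ### The lines of the method as formal and as convergent identities -/

section Lines

variable {M d s : ℕ} {A : ℝ → EuclideanSpace ℝ (Fin d) →L[ℝ] EuclideanSpace ℝ (Fin d)}
  {g : Fin (M + 1) → EuclideanSpace ℝ (Fin d) × ℝ → EuclideanSpace ℝ (Fin d)}
  {x : EuclideanSpace ℝ (Fin d)} {t₀ : ℝ}

open BSeriesERK.Tree

variable (A t₀) in
/-- The term of the tree `chain l` in the B-series of a matrix with weights `ζ`. -/
noncomputable def coeffTerm (ζ : Option (Tree M) → ℝ) (l : List ℕ) :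
    EuclideanSpace ℝ (Fin d) →L[ℝ] EuclideanSpace ℝ (Fin d) :=
  (chainAlpha l * ζ (chain l)) • chainOp A t₀ l

theorem finite_chains (M n : ℕ) : {l | size (chain l : Option (Tree M)) = n}.Finite :=
  Set.Finite.of_injOn (f := (chain : List ℕ → Option (Tree M))) (t := {τ | τ ∈ treesTA M ∧ size τ = n})
    (fun l hl => ⟨chain_mem l, hl⟩) chain_injective.injOn (finite_size_eq _ _)

theorem finite_treesTg (n : ℕ) : {δ | δ ∈ treesTg M ∧ δ.size = n}.Finite :=
  (finite_size_le n).subset fun _ h => le_of_eq h.2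

theorem gradedPart_treesTA (hg : ∀ m, ContDiff ℝ ∞ (g m)) (ζ : Option (Tree M) → ℝ) (n : ℕ) :
    gradedPart (treesTA M) A g x t₀ ζ n =
      ∑ l ∈ (finite_chains M n).toFinset, coeffTerm A t₀ ζ l x := by
  rw [gradedPart_eq_sum]
  symm
  refine Finset.sum_bij (fun l _ => chain l) (fun l hl => ?_) (fun l _ l' _ h => chain_injective h)
    (fun τ hτ => ?_) fun l _ => (bTerm_chain hg ζ l).symm
  · exact (finite_size_eq _ _).mem_toFinset.mpr
      ⟨chain_mem l, (finite_chains M n).mem_toFinset.mp hl⟩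
  · obtain ⟨hT, hn⟩ := (finite_size_eq _ _).mem_toFinset.mp hτ
    obtain ⟨l, rfl⟩ := mem_treesTA_iff.mp hT
    exact ⟨l, (finite_chains M n).mem_toFinset.mpr hn, rfl⟩

theorem mem_treesT_of_treesTg {δ : Tree M} (hδ : δ ∈ treesTg M) : some δ ∈ treesT M := by
  rintro _ ⟨⟩; exact hδ.1

theorem bTerm_compWeight_eq_zero (m : Fin (M + 1)) (φ : Option (Tree M) → ℝ)
    {τ : Option (Tree M)} (hτ : τ ∈ treesT M) (h : ∀ δ ∈ treesTg M, some δ ≠ τ) :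
    bTerm A g x t₀ (compWeight m φ) τ = 0 := by
  cases τ with
  | none => simp [bTerm, compWeight]
  | some τ =>
    have : τ.root ≠ Label.g m := fun hm => h τ ⟨hτ τ rfl, m, hm⟩ rfl
    simp [bTerm, compWeight_of_root_ne m φ this]

theorem gradedPart_compWeight_treesTg (m : Fin (M + 1)) (φ : Option (Tree M) → ℝ) (n : ℕ) :
    gradedPart (treesT M) A g x t₀ (compWeight m φ) n =
      ∑ δ ∈ (finite_treesTg n).toFinset, bTerm A g x t₀ (compWeight m φ) (some δ) := by
  rw [gradedPart_eq_sum]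
  symm
  refine Finset.sum_of_injOn some (Option.some_injective _).injOn (fun δ hδ => ?_)
    (fun τ hτ hnot => ?_) fun _ _ => rfl
  · obtain ⟨hδ, hn⟩ := (finite_treesTg n).mem_toFinset.mp hδ
    exact (finite_size_eq _ _).mem_toFinset.mpr ⟨mem_treesT_of_treesTg hδ, hn⟩
  · obtain ⟨hT, hn⟩ := (finite_size_eq _ _).mem_toFinset.mp hτ
    refine bTerm_compWeight_eq_zero m φ hT fun δ hδ h => hnot ⟨δ, ?_, h⟩
    subst h
    exact (finite_treesTg n).mem_toFinset.mpr ⟨hδ, hn⟩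

theorem treesTA_subset : treesTA M ⊆ treesT M := fun _ h σ hσ => (h σ hσ).1

/-- A line of the method, read as an identity of formal series. -/
theorem IsLine.gradedPart_eq (hg : ∀ m, ContDiff ℝ ∞ (g m)) {z₀ : Option (Tree M) → ℝ}
    {z : Fin (M + 1) → Fin s → Option (Tree M) → ℝ} {φ : Fin s → Option (Tree M) → ℝ}
    {φ' : Option (Tree M) → ℝ} (hφ : IsLine z₀ z φ φ') (n : ℕ) :
    gradedPart (treesT M) A g x t₀ φ' n = gradedPart (treesTA M) A g x t₀ z₀ n +
      ∑ m, ∑ j, ∑ a ∈ Finset.range n, gradedPart (treesTA M) A g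
        (gradedPart (treesT M) A g x t₀ (compWeight m (φ j)) (n - 1 - a + 1)) t₀ (z m j) a := by
  classical
  rw [gradedPart_eq_sum (treesT M), ← Finset.sum_filter_add_sum_filter_not _ (· ∈ treesTA M)]
  congr 1
  · rw [gradedPart_eq_sum]
    refine Finset.sum_congr ?_ fun τ hτ => ?_
    · ext τ
      simp only [Finset.mem_filter, Set.Finite.mem_toFinset, Set.mem_ofPred_eq]
      exact ⟨fun h => ⟨h.2, h.1.2⟩, fun h => ⟨⟨treesTA_subset h.1, h.2⟩, h.1⟩⟩
    · obtain ⟨l, rfl⟩ := mem_treesTA_iff.mp ((finite_size_eq _ _).mem_toFinset.mp hτ).1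
      simp only [bTerm, hφ.chain_eq l]
  · have hrhs : ∑ m, ∑ j, ∑ a ∈ Finset.range n, gradedPart (treesTA M) A g
        (gradedPart (treesT M) A g x t₀ (compWeight m (φ j)) (n - 1 - a + 1)) t₀ (z m j) a =
        ∑ a ∈ Finset.range n, ∑ p ∈ (finite_chains M a).toFinset ×ˢ
          (finite_treesTg (M := M) (n - 1 - a + 1)).toFinset,
            bTerm A g x t₀ φ' (some (graft p.1 p.2)) := by
      have : ∀ a ∈ Finset.range n, ∑ p ∈ (finite_chains M a).toFinset ×ˢ
          (finite_treesTg (M := M) (n - 1 - a + 1)).toFinset,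
            bTerm A g x t₀ φ' (some (graft p.1 p.2)) = ∑ m, ∑ j, gradedPart (treesTA M) A g
        (gradedPart (treesT M) A g x t₀ (compWeight m (φ j)) (n - 1 - a + 1)) t₀ (z m j) a := by
        intro a _
        rw [Finset.sum_congr rfl fun p hp => bTerm_graft hg hφ p.1
          ((finite_treesTg _).mem_toFinset.mp (Finset.mem_product.mp hp).2).1, Finset.sum_comm]
        refine Finset.sum_congr rfl fun m _ => ?_
        rw [Finset.sum_comm]
        refine Finset.sum_congr rfl fun j _ => ?_
        rw [gradedPart_treesTA hg, Finset.sum_product, gradedPart_compWeight_treesTg]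
        refine Finset.sum_congr rfl fun l _ => ?_
        rw [map_sum]
        rfl
      rw [Finset.sum_congr rfl this]
      symm
      rw [Finset.sum_comm]
      refine Finset.sum_congr rfl fun m _ => ?_
      exact Finset.sum_comm
    rw [hrhs, Finset.sum_sigma']
    symm
    refine Finset.sum_bij (fun q _ => some (graft q.2.1 q.2.2)) (fun q hq => ?_)
      (fun q hq q' hq' h => ?_) (fun τ hτ => ?_) fun _ _ => rfl
    · obtain ⟨ha, hp⟩ := Finset.mem_sigma.mp hq
      obtain ⟨hl, hδ⟩ := Finset.mem_product.mp hp
      have hl := (finite_chains M _).mem_toFinset.mp hl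
      obtain ⟨hδ, hn⟩ := (finite_treesTg _).mem_toFinset.mp hδ
      have hT : some (graft q.2.1 q.2.2) ∈ treesT M := by rintro _ ⟨⟩; exact graft_mem _ hδ.1
      refine Finset.mem_filter.mpr ⟨(finite_size_eq _ _).mem_toFinset.mpr ⟨hT, ?_⟩,
        (some_notMem_treesTA_iff hT).mpr ⟨_, _, hδ, rfl⟩⟩
      have ha := Finset.mem_range.mp ha
      rw [Set.mem_ofPred_eq] at hl
      rw [BSeriesERK.size, size_graft, hl, hn]
      omega
    · obtain ⟨_, hp⟩ := Finset.mem_sigma.mp hq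
      obtain ⟨hl, hδ⟩ := Finset.mem_product.mp hp
      obtain ⟨_, hp'⟩ := Finset.mem_sigma.mp hq'
      obtain ⟨hl', hδ'⟩ := Finset.mem_product.mp hp'
      replace hl := (finite_chains M _).mem_toFinset.mp hl
      replace hl' := (finite_chains M _).mem_toFinset.mp hl'
      obtain ⟨a, l, δ⟩ := q
      obtain ⟨a', l', δ'⟩ := q'
      obtain ⟨h1, h2⟩ := graft_injective ((finite_treesTg _).mem_toFinset.mp hδ).1.2
        ((finite_treesTg _).mem_toFinset.mp hδ').1.2 (Option.some.inj h)
      simp only [Set.mem_ofPred_eq] at h1 h2 hl hl'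
      subst h1 h2 hl hl'
      rfl
    · obtain ⟨hτ, hA⟩ := Finset.mem_filter.mp hτ
      obtain ⟨hT, hn⟩ := (finite_size_eq _ _).mem_toFinset.mp hτ
      obtain ⟨l, rfl⟩ | ⟨l, δ, hδ, rfl⟩ := mem_treesT_cases hT
      · exact absurd (chain_mem l) hA
      · rw [BSeriesERK.size, size_graft] at hn
        have := one_le_size δ
        refine ⟨⟨BSeriesERK.size (chain l : Option (Tree M)), l, δ⟩, Finset.mem_sigma.mpr
          ⟨Finset.mem_range.mpr (by dsimp only; omega), Finset.mem_product.mpr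
            ⟨(finite_chains M _).mem_toFinset.mpr rfl,
              (finite_treesTg _).mem_toFinset.mpr ⟨hδ, ?_⟩⟩⟩, rfl⟩
        dsimp only
        omega

theorem IsLine.gradedPart_eq_formalLine (hg : ∀ m, ContDiff ℝ ∞ (g m)) {z₀ : Option (Tree M) → ℝ}
    {z : Fin (M + 1) → Fin s → Option (Tree M) → ℝ} {φ : Fin s → Option (Tree M) → ℝ}
    {φ' : Option (Tree M) → ℝ} (hφ : IsLine z₀ z φ φ') {c : Fin s → ℝ} {h : ℝ}
    (h1 : ∀ j, φ j none = 1) (ht : ∀ j, φ j (some (leaf Label.t)) = c j * h) (n : ℕ) :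
    gradedPart (treesT M) A g x t₀ φ' n =
      formalLine A g x t₀ h c z₀ z (fun j => gradedPart (treesT M) A g x t₀ (φ j)) n := by
  rw [hφ.gradedPart_eq hg, formalLine]
  simp only [taylorPart_gradedPart hg (h1 _) (ht _)]

theorem taylorPart_congr {f : EuclideanSpace ℝ (Fin d) × ℝ → EuclideanSpace ℝ (Fin d)}
    {H H' : ℕ → EuclideanSpace ℝ (Fin d)} {r : ℝ} {b : ℕ} (h : ∀ k ≤ b, H k = H' k) :
    taylorPart f H t₀ r b = taylorPart f H' t₀ r b := by
  have : ∀ ε : ℝ, ∑ k ∈ Finset.range (b + 1), ε ^ k • H k =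
      ∑ k ∈ Finset.range (b + 1), ε ^ k • H' k := fun ε =>
    Finset.sum_congr rfl fun k hk => by rw [h k (Nat.lt_succ_iff.mp (Finset.mem_range.mp hk))]
  simp only [taylorPart, this]

/-- The factor `g_m` itself has degree one, so the stage parts that enter have degree at most `n - 1
- a`. The formal stage equations are therefore explicit degree by degree. -/
theorem formalLine_congr {h : ℝ} {c : Fin s → ℝ} {z₀ : Option (Tree M) → ℝ}
    {z : Fin (M + 1) → Fin s → Option (Tree M) → ℝ}
    {H H' : Fin s → ℕ → EuclideanSpace ℝ (Fin d)} {n : ℕ}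
    (hH : ∀ j, ∀ k < n, H j k = H' j k) :
    formalLine A g x t₀ h c z₀ z H n = formalLine A g x t₀ h c z₀ z H' n := by
  rw [formalLine, formalLine]
  congr 1
  refine Finset.sum_congr rfl fun m _ => Finset.sum_congr rfl fun j _ =>
    Finset.sum_congr rfl fun a ha => ?_
  rw [taylorPart_congr fun k hk => hH j k ?_]
  have := Finset.mem_range.mp ha
  omega

theorem formalLine_solution_iff (hg : ∀ m, ContDiff ℝ ∞ (g m)) {z₀ : Fin s → Option (Tree M) → ℝ}
    {z : Fin (M + 1) → Fin s → Fin s → Option (Tree M) → ℝ} {y₀ : Option (Tree M) → ℝ}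
    {y : Fin (M + 1) → Fin s → Option (Tree M) → ℝ} {φ : Fin s → Option (Tree M) → ℝ}
    {φ' : Option (Tree M) → ℝ} (hφ : ∀ i, IsLine (z₀ i) (fun m j => z m i j) φ (φ i))
    (hφ' : IsLine y₀ y φ φ') {c : Fin s → ℝ} {h : ℝ} (h1 : ∀ j, φ j none = 1)
    (ht : ∀ j, φ j (some (leaf Label.t)) = c j * h)
    (H : Fin s → ℕ → EuclideanSpace ℝ (Fin d)) (Y : ℕ → EuclideanSpace ℝ (Fin d)) :
    ((∀ i n, H i n = formalLine A g x t₀ h c (z₀ i) (fun m j => z m i j) H n) ∧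
      ∀ n, Y n = formalLine A g x t₀ h c y₀ y H n) ↔
    ((∀ i n, H i n = gradedPart (treesT M) A g x t₀ (φ i) n) ∧
      ∀ n, Y n = gradedPart (treesT M) A g x t₀ φ' n) := by
  constructor
  · rintro ⟨hH, hY⟩
    have key : ∀ n i, H i n = gradedPart (treesT M) A g x t₀ (φ i) n := by
      intro n
      induction n using Nat.strong_induction_on with
      | _ n ih =>
        intro i
        rw [hH i n, (hφ i).gradedPart_eq_formalLine hg h1 ht]
        exact formalLine_congr fun j k hk => ih k hk j
    refine ⟨fun i n => key n i, fun n => ?_⟩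
    rw [hY n, hφ'.gradedPart_eq_formalLine hg h1 ht]
    exact formalLine_congr fun j k _ => key k j
  · rintro ⟨hH, hY⟩
    obtain rfl : H = fun j => gradedPart (treesT M) A g x t₀ (φ j) :=
      funext fun j => funext fun n => hH j n
    exact ⟨fun i n => (hφ i).gradedPart_eq_formalLine hg h1 ht n,
      fun n => (hY n).trans (hφ'.gradedPart_eq_formalLine hg h1 ht n)⟩

/-- In finite dimension the operator norm is at most the sum of the norms of the images of the basis
vectors, and there unconditional summability is absolute. -/
theorem summable_norm_of_forall_apply {ι : Type*}
    {L : ι → EuclideanSpace ℝ (Fin d) →L[ℝ] EuclideanSpace ℝ (Fin d)}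
    (h : ∀ v, Summable fun i => L i v) : Summable fun i => ‖L i‖ := by
  have h1 : Summable fun i => ∑ k : Fin d, ‖L i (EuclideanSpace.single k 1)‖ :=
    summable_sum fun k _ => (h _).norm
  refine Summable.of_nonneg_of_le (fun _ => norm_nonneg _) (fun i => ?_) h1
  refine ContinuousLinearMap.opNorm_le_bound _ (Finset.sum_nonneg fun _ _ => norm_nonneg _)
    fun v => ?_
  have hv : v = ∑ k, v k • EuclideanSpace.single k (1 : ℝ) := by
    ext j
    simp [Finset.sum_apply, Pi.single_apply]
  conv_lhs => rw [hv, map_sum]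
  rw [Finset.sum_mul]
  refine (norm_sum_le _ _).trans (Finset.sum_le_sum fun k _ => ?_)
  rw [map_smul, norm_smul, mul_comm]
  exact mul_le_mul_of_nonneg_left (PiLp.norm_apply_le v k) (norm_nonneg _)

theorem HasCoeffSeries.hasSum_coeffTerm (hg : ∀ m, ContDiff ℝ ∞ (g m)) {ζ : Option (Tree M) → ℝ}
    {L : EuclideanSpace ℝ (Fin d) →L[ℝ] EuclideanSpace ℝ (Fin d)}
    (h : HasCoeffSeries A g t₀ ζ L) (v : EuclideanSpace ℝ (Fin d)) :
    HasSum (fun l => coeffTerm A t₀ ζ l v) (L v) := by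
  let e : List ℕ ≃ treesTA M := Equiv.ofBijective (fun l => ⟨chain l, chain_mem l⟩)
    ⟨fun l l' h => chain_injective (congrArg Subtype.val h), fun ⟨τ, hτ⟩ => by
      obtain ⟨l, rfl⟩ := mem_treesTA_iff.mp hτ
      exact ⟨l, rfl⟩⟩
  have := e.hasSum_iff.mpr (h v)
  convert this using 2 with l
  exact (bTerm_chain hg ζ l).symm

/-- Absolute summability of both factors dominates the double family; summing first over the vectors
and then over the chains identifies its sum. -/
theorem HasCoeffSeries.hasSum_prod (hg : ∀ m, ContDiff ℝ ∞ (g m)) {ζ : Option (Tree M) → ℝ}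
    {L : EuclideanSpace ℝ (Fin d) →L[ℝ] EuclideanSpace ℝ (Fin d)}
    (h : HasCoeffSeries A g t₀ ζ L) {ι : Type*} {v : ι → EuclideanSpace ℝ (Fin d)}
    {w : EuclideanSpace ℝ (Fin d)} (hv : HasSum v w) :
    HasSum (fun p : List ℕ × ι => coeffTerm A t₀ ζ p.1 (v p.2)) (L w) := by
  have h1 : Summable fun l => ‖coeffTerm A t₀ ζ l‖ :=
    summable_norm_of_forall_apply fun y => (h.hasSum_coeffTerm hg y).summable
  have h2 : Summable fun p : List ℕ × ι => coeffTerm A t₀ ζ p.1 (v p.2) := by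
    refine Summable.of_norm_bounded (h1.mul_of_nonneg hv.summable.norm
      (fun _ => norm_nonneg _) fun _ => norm_nonneg _) fun p => ?_
    exact ContinuousLinearMap.le_opNorm _ _
  have h3 := h2.hasSum.prod_fiberwise fun l => (coeffTerm A t₀ ζ l).hasSum hv
  rw [(h.hasSum_coeffTerm hg w).unique h3]
  exact h2.hasSum

/-- A line of the method, read as an identity of convergent series. -/
theorem IsLine.hasSum (hg : ∀ m, ContDiff ℝ ∞ (g m)) {z₀ : Option (Tree M) → ℝ}
    {z : Fin (M + 1) → Fin s → Option (Tree M) → ℝ} {φ : Fin s → Option (Tree M) → ℝ}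
    {φ' : Option (Tree M) → ℝ} (hφ : IsLine z₀ z φ φ')
    {Z₀ : EuclideanSpace ℝ (Fin d) →L[ℝ] EuclideanSpace ℝ (Fin d)}
    {Z : Fin (M + 1) → Fin s → EuclideanSpace ℝ (Fin d) →L[ℝ] EuclideanSpace ℝ (Fin d)}
    (hZ₀ : HasCoeffSeries A g t₀ z₀ Z₀) (hZ : ∀ m j, HasCoeffSeries A g t₀ (z m j) (Z m j))
    {v : Fin (M + 1) → Fin s → EuclideanSpace ℝ (Fin d)}
    (hv : ∀ m j, HasSum (fun τ : treesT M => bTerm A g x t₀ (compWeight m (φ j)) τ) (v m j)) :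
    HasSum (fun τ : treesT M => bTerm A g x t₀ φ' τ) (Z₀ x + ∑ m, ∑ j, Z m j (v m j)) := by
  have hvg : ∀ m j, HasSum (fun δ : treesTg M =>
      bTerm A g x t₀ (compWeight m (φ j)) (some (δ : Tree M))) (v m j) := by
    intro m j
    let e : treesTg M → treesT M := fun δ => ⟨some δ, mem_treesT_of_treesTg δ.2⟩
    have he : Function.Injective e := fun δ δ' h =>
      Subtype.ext (Option.some.inj (congrArg Subtype.val h))
    refine (he.hasSum_iff fun τ hτ => ?_).mpr (hv m j)
    exact bTerm_compWeight_eq_zero m (φ j) τ.2 fun δ hδ h => hτ ⟨⟨δ, hδ⟩, Subtype.ext h⟩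
  -- The decomposition of `T` as a bijection: chains carry `Z₀ x`, grafts carry the products with
  -- the `g_m` series.
  let e : List ℕ ⊕ (List ℕ × treesTg M) ≃ treesT M := Equiv.ofBijective
    (Sum.elim (fun l => ⟨chain l, treesTA_subset (chain_mem l)⟩)
      (fun p => ⟨some (graft p.1 p.2), by rintro _ ⟨⟩; exact graft_mem _ p.2.2.1⟩))
    ⟨by
      rintro (l | ⟨l, δ, hδ⟩) (l' | ⟨l', δ', hδ'⟩) h
      · rw [chain_injective (congrArg Subtype.val h)]
      · exact absurd (congrArg Subtype.val h) (chain_ne_graft l l' hδ')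
      · exact absurd (congrArg Subtype.val h).symm (chain_ne_graft l' l hδ)
      · obtain ⟨rfl, rfl⟩ := graft_injective hδ.2 hδ'.2
          (Option.some.inj (congrArg Subtype.val h))
        rfl, by
      rintro ⟨τ, hτ⟩
      obtain ⟨l, rfl⟩ | ⟨l, δ, hδ, rfl⟩ := mem_treesT_cases hτ
      · exact ⟨Sum.inl l, rfl⟩
      · exact ⟨Sum.inr (l, ⟨δ, hδ⟩), rfl⟩⟩
  rw [← e.hasSum_iff]
  refine HasSum.sum ?_ ?_
  · convert hZ₀.hasSum_coeffTerm hg x using 2 with l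
    change bTerm A g x t₀ φ' (chain l) = _
    rw [bTerm_chain hg, hφ.chain_eq]
    rfl
  · have := hasSum_sum (s := Finset.univ) fun m (_ : m ∈ Finset.univ) =>
      hasSum_sum (s := Finset.univ) fun j (_ : j ∈ Finset.univ) => (hZ m j).hasSum_prod hg (hvg m j)
    convert this using 2 with p
    change bTerm A g x t₀ φ' (some (graft p.1 p.2)) = _
    rw [bTerm_graft hg hφ p.1 p.2.2]
    rfl

/-- Regrouping by number of nodes, with finite groups, passes from a sum over trees to a series in
one index. -/
theorem hasSum_gradedPart {𝒯 : Set (Option (Tree M))} {φ : Option (Tree M) → ℝ}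
    {v : EuclideanSpace ℝ (Fin d)} (h : HasSum (fun τ : 𝒯 => bTerm A g x t₀ φ τ) v) :
    HasSum (gradedPart 𝒯 A g x t₀ φ) v := by
  have h1 := (Equiv.sigmaFiberEquiv fun τ : 𝒯 => BSeriesERK.size (τ : Option (Tree M))).hasSum_iff.mpr h
  refine h1.sigma fun n => ?_
  let e : (finite_size_eq 𝒯 n).toFinset ≃ {τ : 𝒯 // BSeriesERK.size (τ : Option (Tree M)) = n} :=
    { toFun := fun τ => ⟨⟨τ, ((finite_size_eq 𝒯 n).mem_toFinset.mp τ.2).1⟩,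
        ((finite_size_eq 𝒯 n).mem_toFinset.mp τ.2).2⟩
      invFun := fun τ => ⟨τ.1.1, (finite_size_eq 𝒯 n).mem_toFinset.mpr ⟨τ.1.2, τ.2⟩⟩
      left_inv := fun _ => rfl
      right_inv := fun _ => rfl }
  rw [← e.hasSum_iff, gradedPart_eq_sum]
  exact (finite_size_eq 𝒯 n).toFinset.hasSum (bTerm A g x t₀ φ)

theorem hasSum_compWeight (hg : ∀ m, ContDiff ℝ ∞ (g m)) {φ : Option (Tree M) → ℝ} {r : ℝ}
    (hφ : φ none = 1) (hr : φ (some (leaf Label.t)) = r) (m : Fin (M + 1))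
    (han : AnalyticOnNhd ℝ (g m) Set.univ) {H : EuclideanSpace ℝ (Fin d)}
    (hH : HasSum (fun τ : treesT M => bTerm A g x t₀ φ τ) H)
    (hs : Summable fun τ : treesT M => bTerm A g x t₀ (compWeight m φ) τ) :
    HasSum (fun τ : treesT M => bTerm A g x t₀ (compWeight m φ) τ) (g m (H, t₀ + r)) := by
  have ha := hasSum_gradedPart hH
  have hb := hasSum_gradedPart hs.hasSum
  have h0 : gradedPart (treesT M) A g x t₀ (compWeight m φ) 0 = 0 := by
    rw [gradedPart_zero (by simp [treesT])]
    simp [compWeight]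
  -- The degree zero part of the `g_m` series vanishes; dropping it aligns degree `n + 1` of that
  -- series with the Taylor coefficient of order `n`.
  rw [← hasSum_nat_add_iff' 1] at hb
  simp only [Finset.range_one, Finset.sum_singleton, h0, sub_zero] at hb
  have := apply_tsum_eq_tsum_taylor han ha.summable.norm hb.summable.norm t₀ r
    fun n => (taylorPart_gradedPart hg hφ hr m n).symm
  rw [ha.tsum_eq, hb.tsum_eq] at this
  rw [this]
  exact hs.hasSum

end Lines

end BSeriesERK

/-! ### The main theorem -/

open BSeriesERK in
theorem theorem3 {M s : ℕ} {Ω : Type*} [MeasurableSpace Ω] (c : Fin s → ℝ)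
    (ζ₀ : Fin s → Option (Tree M) → ℝ → Ω → ℝ)
    (ζ : Fin (M + 1) → Fin s → Fin s → Option (Tree M) → ℝ → Ω → ℝ)
    (η₀ : Option (Tree M) → ℝ → Ω → ℝ)
    (η : Fin (M + 1) → Fin s → Option (Tree M) → ℝ → Ω → ℝ)
    (hζ₀ : ∀ i h w, ζ₀ i none h w = 1) (hη₀ : ∀ h w, η₀ none h w = 1) :
    -- the splitting used in the recursion exists and is unique
    (∀ τ : Tree M, some τ ∈ treesT M → some τ ∉ treesTA M →
      ∃! p : Option (Tree M) × Tree M, p ∈ SP τ ∧ p.1 ∈ treesTA M ∧ p.2 ∈ treesTg M) ∧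
    ∃ (Φ : Fin s → Option (Tree M) → ℝ → Ω → ℝ) (Φ' : Option (Tree M) → ℝ → Ω → ℝ),
      -- the weights satisfy the recursion, which determines them on all trees
      IsERKWeights c ζ₀ ζ η₀ η Φ Φ' ∧
      (∀ Ψ Ψ', IsERKWeights c ζ₀ ζ η₀ η Ψ Ψ' →
        ∀ τ ∈ treesT M, (∀ i, Ψ i τ = Φ i τ) ∧ Ψ' τ = Φ' τ) ∧
      -- they are random variables if the weights of the coefficients are
      ((∀ τ ∈ treesTA M, ∀ h, (∀ i, Measurable (ζ₀ i τ h)) ∧ (∀ m i j, Measurable (ζ m i j τ h)) ∧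
          Measurable (η₀ τ h) ∧ ∀ m i, Measurable (η m i τ h)) →
        ∀ τ ∈ treesT M, ∀ h, (∀ i, Measurable (Φ i τ h)) ∧ Measurable (Φ' τ h)) ∧
      ∀ (d : ℕ) (A : ℝ → EuclideanSpace ℝ (Fin d) →L[ℝ] EuclideanSpace ℝ (Fin d))
        (g : Fin (M + 1) → EuclideanSpace ℝ (Fin d) × ℝ → EuclideanSpace ℝ (Fin d)),
        ContDiff ℝ ∞ A → (∀ m, ContDiff ℝ ∞ (g m)) →
        ∀ (x₀ : EuclideanSpace ℝ (Fin d)) (t₀ h : ℝ) (w : Ω),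
        -- as formal series, the method has exactly one solution, given by the B-series
        (∀ (H : Fin s → ℕ → EuclideanSpace ℝ (Fin d)) (Y : ℕ → EuclideanSpace ℝ (Fin d)),
          ((∀ i n, H i n = formalLine A g x₀ t₀ h c (fun τ => ζ₀ i τ h w)
              (fun m j τ => ζ m i j τ h w) H n) ∧
            (∀ n, Y n = formalLine A g x₀ t₀ h c (fun τ => η₀ τ h w)
              (fun m j τ => η m j τ h w) H n)) ↔
          ((∀ i n, H i n = gradedPart (treesT M) A g x₀ t₀ (fun τ => Φ i τ h w) n) ∧
            (∀ n, Y n = gradedPart (treesT M) A g x₀ t₀ (fun τ => Φ' τ h w) n))) ∧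
        -- if the series converge, their sums are stage values and the one-step approximation
        (∀ (Z₀ : Fin s → EuclideanSpace ℝ (Fin d) →L[ℝ] EuclideanSpace ℝ (Fin d))
          (Z : Fin (M + 1) → Fin s → Fin s →
            EuclideanSpace ℝ (Fin d) →L[ℝ] EuclideanSpace ℝ (Fin d))
          (z₀ : EuclideanSpace ℝ (Fin d) →L[ℝ] EuclideanSpace ℝ (Fin d))
          (z : Fin (M + 1) → Fin s → EuclideanSpace ℝ (Fin d) →L[ℝ] EuclideanSpace ℝ (Fin d)),
          (∀ i, HasCoeffSeries A g t₀ (fun τ => ζ₀ i τ h w) (Z₀ i)) →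
          (∀ m i j, HasCoeffSeries A g t₀ (fun τ => ζ m i j τ h w) (Z m i j)) →
          HasCoeffSeries A g t₀ (fun τ => η₀ τ h w) z₀ →
          (∀ m i, HasCoeffSeries A g t₀ (fun τ => η m i τ h w) (z m i)) →
          (∀ m, AnalyticOnNhd ℝ (g m) Set.univ) →
          (∀ i, Summable fun τ : treesT M => bTerm A g x₀ t₀ (fun σ => Φ i σ h w) τ) →
          (∀ m i, Summable fun τ : treesT M =>
            bTerm A g x₀ t₀ (compWeight m fun σ => Φ i σ h w) τ) →
          ∃ H : Fin s → EuclideanSpace ℝ (Fin d),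
            (∀ i, H i = methodLine g x₀ t₀ h c (Z₀ i) (fun m j => Z m i j) H) ∧
            (∀ i, HasSum (fun τ : treesT M => bTerm A g x₀ t₀ (fun σ => Φ i σ h w) τ) (H i)) ∧
            HasSum (fun τ : treesT M => bTerm A g x₀ t₀ (fun σ => Φ' σ h w) τ)
              (methodLine g x₀ t₀ h c z₀ z H)) := by
  refine ⟨fun τ hτ hA => existsUnique_splitting hτ hA,
    fun i τ h w => stageWeight (fun j => c j * h) (fun j τ => ζ₀ j τ h w)
      (fun m i j τ => ζ m i j τ h w) i τ,
    fun τ h w => lineWeight (fun τ => η₀ τ h w) (fun m j τ => η m j τ h w)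
      (stageWeight (fun j => c j * h) (fun j τ => ζ₀ j τ h w) (fun m i j τ => ζ m i j τ h w)) τ,
    ?_⟩
  -- The weights are built separately for each `h` and `w`. From here on only the recursion they
  -- satisfy is used.
  generalize hΦ : (fun i τ h w => stageWeight (fun j => c j * h) (fun j τ => ζ₀ j τ h w)
      (fun m i j τ => ζ m i j τ h w) i τ : Fin s → Option (Tree M) → ℝ → Ω → ℝ) = Φ
  generalize hΦ' : (fun τ h w => lineWeight (fun τ => η₀ τ h w) (fun m j τ => η m j τ h w)
      (stageWeight (fun j => c j * h) (fun j τ => ζ₀ j τ h w) (fun m i j τ => ζ m i j τ h w)) τ :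
      Option (Tree M) → ℝ → Ω → ℝ) = Φ'
  have hERK : IsERKWeights c ζ₀ ζ η₀ η Φ Φ' := by
    subst hΦ hΦ'
    exact isERKWeights_of_isLine hζ₀ hη₀ (fun i h w => stageWeight_time _ _ _ i)
      (fun i h w => isLine_stageWeight (fun j => c j * h) (fun j τ => ζ₀ j τ h w)
        (fun m i j τ => ζ m i j τ h w) i) fun h w => isLine_lineWeight _ _ _
  refine ⟨hERK, fun Ψ Ψ' hΨ τ hτ => hERK.unique hΨ hτ, fun hm τ hτ h => hERK.measurable hm hτ h,
    fun d A g _ hg x₀ t₀ h w => ⟨fun H Y => ?_, ?_⟩⟩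
  · exact formalLine_solution_iff hg (fun i => hERK.isLine_stage i h w) (hERK.isLine_step h w)
      (fun j => hERK.stage_empty j h w) (fun j => hERK.stage_time j h w) H Y
  · intro Z₀ Z z₀ z hZ₀ hZ hz₀ hz han hs hsc
    have hv : ∀ m j, HasSum (fun τ : treesT M =>
        bTerm A g x₀ t₀ (compWeight m fun σ => Φ j σ h w) τ)
        (g m (∑' τ : treesT M, bTerm A g x₀ t₀ (fun σ => Φ j σ h w) τ, t₀ + c j * h)) :=
      fun m j => hasSum_compWeight hg (hERK.stage_empty j h w) (hERK.stage_time j h w) m (han m)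
        (hs j).hasSum (hsc m j)
    -- The stage values are the sums of their series; the line identity gives the same series a
    -- second sum, and uniqueness of sums is the stage equation.
    exact ⟨fun i => ∑' τ : treesT M, bTerm A g x₀ t₀ (fun σ => Φ i σ h w) τ,
      fun i => (hs i).hasSum.unique
        ((hERK.isLine_stage i h w).hasSum hg (hZ₀ i) (fun m j => hZ m i j) hv),
      fun i => (hs i).hasSum,
      (hERK.isLine_step h w).hasSum hg hz₀ hz hv⟩
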